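/- **Setting.** Let $\mathbb H^2=\mathbb C^2\times\mathbb R\cong\mathbb R^4\times\mathbb R$ be the Heisenberg group with coordinates $(z,\varphi)$, $z=(z_1,\dots,z_4)$, group law $(z,\varphi)*(z',\varphi')=\big(z+z',\varphi+\varphi'+\sum_{j=1}^2(z_{2j-1}z'_{2j}-z_{2j}z'_{2j-1})\big)$, contact form $\alpha=-d\varphi+\sum_{j=1}^2(z_{2j-1}dz_{2j}-z_{2j}dz_{2j-1})$, and the Riemannian metric for which $X_j=\partial_{z_{2j-1}}-z_{2j}\partial_\varphi$, $Y_j=\partial_{z_{2j}}+z_{2j-1}\partial_\varphi$ $(j=1,2)$ and $\partial_\varphi$ are orthonormal. Let $H=\ker\alpha$, let $J_H$ be the complex structure on $H$ with $J_HX_j=Y_j$, and let $\nabla^H F$ be the orthogonal projection of $\nabla F$ onto $H$. For a smooth function $F$ let $W_F$ be the Hamiltonian vector field given by $2W_F=J_H\nabla^HF-2F\partial_\varphi$. Let $\Pi:G\to\mathbb H^2$ be the bundle of Legendrian planes, i.e. of the two-dimensional subspaces $\mathcal P\subset H_p$ on which $d\alpha$ vanishes; $\nabla^{\mathcal P}f$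 is the orthogonal projection of $\nabla f$ onto $\mathcal P$, and $\operatorname{div}_{\mathcal P}W=\sum_{k=1}^2\langle\nabla_{Z_k}W,Z_k\rangle$ for an orthonormal basis $(Z_1,Z_2)$ of $\mathcal P$, where $\nabla$ is the Levi-Civita connection. A *Hamiltonian stationary Legendrian varifold (HSLV)* on an open set $U\subseteq\mathbb H^2$ is a Radon measure $\mathbf v$ on $\Pi^{-1}(U)$ with $\int\operatorname{div}_{\mathcal P}W_F\,d\mathbf v(\mathcal P,p)=0$ for all $F\in C^\infty_c(U)$. Its weight is $|\mathbf v|=\Pi_*\mathbf v$. Let $\rho^2=|z|^2$, $\sigma=2\varphi/\rho^2$ and $\mathfrak r=(\rho^4+4\varphi^2)^{1/4}$ (the Folland–Korányi gauge); $\arctan\sigma$ is extended continuously to $\mathbb H^2\setminus\{0\}$, with the value $\operatorname{sgn}(\varphi)\frac{\pi}{2}$ where $\rho=0$. Put $\mathfrak r_q(x)=\mathfrak r(q^{-1}*x)$, and define $\varphi_q$ and $\arctan\sigma_q$ in the same way. Let $d_K(p,q)=\mathfrak r(p^{-1}*q)$ be the Korányi distance, $B^{\mathfrak r}_s(q)$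 and $\bar B^{\mathfrak r}_s(q)$ its open and closed balls, and $d_K(q,\mathbb H^2\setminus U)=\inf_{p\notin U}d_K(q,p)$ (equal to $\infty$ if $U=\mathbb H^2$). Fix a smooth cut-off function $\chi$ with $\chi(t)=1$ for $t\le1$, $\chi(t)=0$ for $t\ge2$, and $-\chi'=\eta^2$ for some $\eta\in C^\infty_c((1,2))$. For a HSLV $\mathbf v$ on $U$ let \begin{align*}\Theta^\chi(q,a):=&-\int_{G}\frac{|\nabla^{\mathcal P}\mathfrak r_q|^2}{\mathfrak r_q}a^{-1}\chi'(\mathfrak r_q/a)\,d\mathbf v(\mathcal P,p)-\int_{G}\frac{2\varphi_q}{\mathfrak r_q^3}a^{-1}\chi'(\mathfrak r_q/a)\arctan\sigma_q\,d\mathbf v(\mathcal P,p)\\&+\frac14\int_{G}\mathfrak r_q^4\,\nabla^{\mathcal P}\arctan\sigma_q\cdot\nabla^{\mathcal P}\big[\mathfrak r_q^{-3}a^{-1}\chi'(\mathfrak r_q/a)\arctan\sigma_q\big]\,d\mathbf v(\mathcal P,p).\end{align*} **Theorem (monotonicity formula).** For every $\chi$ as above there is a constant $C>0$, depending only on $\chi$,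 such that the following holds for every open set $U\subseteq\mathbb H^2$, every HSLV $\mathbf v$ on $U$ and every $q\in U$. 1. For $0<a\le d_K(q,\mathbb H^2\setminus U)/2$ the integrals defining $\Theta^\chi(q,a)$ converge absolutely, and $$0\le\Theta^\chi(q,a)\le\Theta^\chi(q,b)\quad\text{for all }0<a<b\le d_K(q,\mathbb H^2\setminus U)/2.$$ 2. The density $$\theta^\chi(q):=\lim_{\varepsilon\to0^+}-\frac1\varepsilon\int_G\chi'(\mathfrak r_q/\varepsilon)\left[\frac{|\nabla^{\mathcal P}\mathfrak r_q|^2}{\mathfrak r_q}+\frac{2\varphi_q}{\mathfrak r_q^3}\arctan\sigma_q\right]d\mathbf v(\mathcal P,p)$$ exists in $[0,\infty)$, and $\theta^\chi(q)=\lim_{\varepsilon\to0^+}\Theta^\chi(q,\varepsilon)$. 3. For all $0<b\le d_K(q,\mathbb H^2\setminus U)/2$, $$\theta^\chi(q)+\int_{0<\mathfrak r_q<b}|\nabla^{\mathcal P}\arctan\sigma_q|^2\,d\mathbf v(\mathcal P,p)\le C\,b^{-2}\,|\mathbf v|\big(B^{\mathfrak r}_{2b}(q)\setminus\bar B^{\mathfrak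 r}_b(q)\big)$$ (where the right-hand side may be $+\infty$). -/

import Mathlib

open MeasureTheory Filter Topology Set
open scoped ENNReal ContDiff Matrix

noncomputable section

namespace Heisenberg

/-! ### The Heisenberg group over `ℂ²` -/

/-- The Heisenberg group `ℍ²` in its global coordinates `(z, φ)`, where
`z = (z₁, z₂, z₃, z₄) ∈ ℝ⁴ ≅ ℂ²` is indexed by `Fin 4` (so `z₁` is `z 0`) and `φ` is the Legendrian
coordinate. Only the topology and the smooth structure of `ℝ⁵` are used. The group operation is
`Heisenberg.mul`, not the addition of `ℝ⁵`. -/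
abbrev Heis : Type := (Fin 4 → ℝ) × ℝ

/-- Multiplication by `i` on `ℂ² ≅ ℝ⁴`: `(z₁, z₂, z₃, z₄) ↦ (-z₂, z₁, -z₄, z₃)`. -/
def mulI (z : Fin 4 → ℝ) : Fin 4 → ℝ := ![-z 1, z 0, -z 3, z 2]

/-- The group law `(z,φ) * (z',φ') = (z + z', φ + φ' + ∑ⱼ (z₂ⱼ₋₁ z'₂ⱼ - z₂ⱼ z'₂ⱼ₋₁))`. -/
def mul (p q : Heis) : Heis :=
  (p.1 + q.1, p.2 + q.2 + (p.1 0 * q.1 1 - p.1 1 * q.1 0) + (p.1 2 * q.1 3 - p.1 3 * q.1 2))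

/-- The group inverse `(z,φ)⁻¹ = (-z,-φ)`. -/
def inv (p : Heis) : Heis := (-p.1, -p.2)

/-- The horizontal frame `(X₁, Y₁, X₂, Y₂)` at `p`, where
`Xⱼ = ∂/∂z₂ⱼ₋₁ - z₂ⱼ ∂/∂φ` and `Yⱼ = ∂/∂z₂ⱼ + z₂ⱼ₋₁ ∂/∂φ`. -/
def frame (p : Heis) : Fin 4 → Heis :=
  ![(![1, 0, 0, 0], -p.1 1), (![0, 1, 0, 0], p.1 0),
    (![0, 0, 1, 0], -p.1 3), (![0, 0, 0, 1], p.1 2)]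

/-- The contact form `α = -dφ + ∑ⱼ (z₂ⱼ₋₁ dz₂ⱼ - z₂ⱼ dz₂ⱼ₋₁)` at `p`, applied to `v`. -/
def contactForm (p v : Heis) : ℝ :=
  -v.2 + (p.1 0 * v.1 1 - p.1 1 * v.1 0) + (p.1 2 * v.1 3 - p.1 3 * v.1 2)

/-- The Riemannian metric `g = π^* g_{ℂ²} + α ⊗ α`, for which `(X₁, Y₁, X₂, Y₂, ∂_φ)` is
orthonormal at every point. -/
def metric (p v w : Heis) : ℝ := v.1 ⬝ᵥ w.1 + contactForm p v * contactForm p w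

/-- The derivative at `p`, in the direction `u`, of the metric coefficient `x ↦ g_x(v, w)`, for
constant (coordinate) vectors `v`, `w`. -/
def metricDeriv (p u v w : Heis) : ℝ := fderiv ℝ (fun x => metric x v w) p u

/-- `g_p(∇_Z W, Y)`, where `∇` is the Levi-Civita connection of `g`, written in the
global coordinates: the Euclidean derivative of `W` plus the Christoffel symbols of the first
kind. -/
def covDerivInner (W : Heis → Heis) (p Z Y : Heis) : ℝ :=
  metric p (fderiv ℝ W p Z) Y +
    (1 / 2) * (metricDeriv p Z (W p) Y + metricDeriv p (W p) Z Y - metricDeriv p Y Z (W p))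

/-- The horizontal gradient `∇^H f`, by its components in the frame `(X₁, Y₁, X₂, Y₂)`. -/
def hGrad (f : Heis → ℝ) (p : Heis) : Fin 4 → ℝ := fun i => fderiv ℝ f p (frame p i)

/-- The Hamiltonian vector field `W_F`, given by `2 W_F = J_H ∇^H F - 2 F ∂_φ`, where `J_H Xⱼ = Yⱼ`
and `J_H Yⱼ = -Xⱼ`. -/
def hamField (F : Heis → ℝ) (p : Heis) : Heis :=
  (1 / 2 : ℝ) • ((∑ i, mulI (hGrad F p) i • frame p i) - (2 * F p) • ((0, 1) : Heis))

/-! ### Gauge, phase and distance -/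

/-- `ρ² = |z|²`. -/
def rhoSq (p : Heis) : ℝ := ∑ i, p.1 i ^ 2

/-- The Folland–Korányi gauge `𝔯 = (ρ⁴ + 4φ²)^{1/4}`. -/
def gauge (p : Heis) : ℝ := (rhoSq p ^ 2 + 4 * p.2 ^ 2) ^ (1 / 4 : ℝ)

/-- `arctan σ`, where `σ = 2φ/ρ²` is the phase, with its continuous extension `sgn(φ) π/2` to
the punctured axis `{ρ = 0, φ ≠ 0}` (and the value `0` at the origin). -/
def arctanPhase (p : Heis) : ℝ :=
  if rhoSq p = 0 then SignType.sign p.2 * (Real.pi / 2) else Real.arctan (2 * p.2 / rhoSq p)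

/-- The Korányi distance `d_K(p, q) = 𝔯(p⁻¹ * q)`. -/
def dK (p q : Heis) : ℝ := gauge (mul (inv p) q)

/-- The distance `d_K(q, ℍ² \ U)` (which is `∞` for `U = ℍ²`). -/
def distCompl (q : Heis) (U : Set Heis) : ℝ≥0∞ := ⨅ p ∈ Uᶜ, ENNReal.ofReal (dK q p)

/-- `𝔯_q(x) = 𝔯(q⁻¹ * x)`. -/
def gaugeAt (q x : Heis) : ℝ := gauge (mul (inv q) x)

/-- `φ_q(x) = φ(q⁻¹ * x)`. -/
def phiAt (q x : Heis) : ℝ := (mul (inv q) x).2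

/-- `(arctan σ_q)(x) = (arctan σ)(q⁻¹ * x)`. -/
def arctanPhaseAt (q x : Heis) : ℝ := arctanPhase (mul (inv q) x)

/-! ### The bundle of Legendrian planes and tangential operators -/

/-- The Grassmannian of Lagrangian planes in `ℂ² ≅ ℝ⁴`. As usual, a plane is
identified with the matrix of the orthogonal projection onto it: a symmetric idempotent matrix of
trace `2`, on whose range the symplectic form `ω(v, w) = ⟨iv, w⟩` vanishes. -/
abbrev LagrangianPlane : Type :=
  {M : Matrix (Fin 4) (Fin 4) ℝ // Mᵀ = M ∧ M * M = M ∧ M.trace = 2 ∧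
    ∀ v w : Fin 4 → ℝ, mulI (M *ᵥ v) ⬝ᵥ (M *ᵥ w) = 0}

instance : MeasurableSpace LagrangianPlane := borel _

instance : BorelSpace LagrangianPlane := ⟨rfl⟩

/-- The bundle `G` of Legendrian planes (two-dimensional subspaces of `ker α` on which `dα`
vanishes) over `ℍ²`, trivialized by the orthonormal horizontal frame `(X₁, Y₁, X₂, Y₂)`: the pair
`(p, M)` stands for the plane at `p` consisting of the vectors `∑ᵢ cᵢ Eᵢ(p)` with `c` in the range
of `M`, where `(E₀, E₁, E₂, E₃) = (X₁, Y₁, X₂, Y₂)`. The bundle projection `Π` is `Prod.fst`. -/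
abbrev LegendrianGrassmannian : Type := Heis × LagrangianPlane

instance : SecondCountableTopology (Matrix (Fin 4) (Fin 4) ℝ) :=
  inferInstanceAs (SecondCountableTopology (Fin 4 → Fin 4 → ℝ))

instance : BorelSpace LegendrianGrassmannian := Prod.borelSpace

/-- The tangential gradient `∇^𝒫 f`, i.e. the orthogonal projection of the gradient of `f` onto
the plane `𝒫 = (p, M)`, by its components in the orthonormal frame `(X₁, Y₁, X₂, Y₂)`. -/
def tGrad (f : Heis → ℝ) (P : LegendrianGrassmannian) : Fin 4 → ℝ := P.2.1 *ᵥ hGrad f P.1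

/-- The tangential divergence `div_𝒫 W = ∑ₖ g(∇_{Z_k} W, Z_k)`, with `(Z₁, Z₂)` an orthonormal basis
of `𝒫 = (p, M)`; as `∑ₖ Z_k ⊗ Z_k` has the matrix `M` in the frame `E`, this is
`∑ᵢⱼ Mᵢⱼ g(∇_{Eᵢ} W, Eⱼ)`. -/
def tDiv (W : Heis → Heis) (P : LegendrianGrassmannian) : ℝ :=
  ∑ i, ∑ j, P.2.1 i j * covDerivInner W P.1 (frame P.1 i) (frame P.1 j)

/-! ### Varifolds -/

/-- `v` is a Hamiltonian stationary Legendrian varifold on the open set `U`: a Borel measure on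
`Π⁻¹(U)` (viewed as a measure on `G` that does not charge the complement of `Π⁻¹(U)`), finite on
the compact subsets of `Π⁻¹(U)`, with `∫ div_𝒫 W_F dv = 0` for all `F ∈ C_c^∞(U)`. -/
structure IsHSLV (U : Set Heis) (v : Measure LegendrianGrassmannian) : Prop where
  concentrated : v (Prod.fst ⁻¹' U)ᶜ = 0
  finite_on_compacts : ∀ K : Set LegendrianGrassmannian, IsCompact K → K ⊆ Prod.fst ⁻¹' U → v K < ⊤
  stationary : ∀ F : Heis → ℝ, ContDiff ℝ ∞ F → HasCompactSupport F → tsupport F ⊆ U →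
    ∫ P, tDiv (hamField F) P ∂v = 0

/-- The weight `|v| = Π_* v`. -/
def weight (v : Measure LegendrianGrassmannian) : Measure Heis := v.map Prod.fst

/-! ### Cut-off functions and the monotone quantity -/

/-- The admissible cut-off functions: `χ` smooth, `χ = 1` up to `1`, `χ = 0` from `2` on, and
`-χ' = η²` for some `η ∈ C_c^∞((1,2))`. -/
structure IsCutoff (χ : ℝ → ℝ) : Prop where
  smooth : ContDiff ℝ ∞ χ
  eq_one : ∀ t ≤ 1, χ t = 1
  eq_zero : ∀ t, 2 ≤ t → χ t = 0
  neg_deriv_eq_sq : ∃ η : ℝ → ℝ, ContDiff ℝ ∞ η ∧ HasCompactSupport η ∧ tsupport η ⊆ Ioo 1 2 ∧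
    ∀ t, -deriv χ t = η t ^ 2

/-- The integrand `|∇^𝒫 𝔯_q|² / 𝔯_q · a⁻¹ χ'(𝔯_q/a)`. -/
def integrandGauge (χ : ℝ → ℝ) (q : Heis) (a : ℝ) (P : LegendrianGrassmannian) : ℝ :=
  (tGrad (gaugeAt q) P ⬝ᵥ tGrad (gaugeAt q) P) / gaugeAt q P.1 *
    (a⁻¹ * deriv χ (gaugeAt q P.1 / a))

/-- The integrand `2 φ_q / 𝔯_q³ · a⁻¹ χ'(𝔯_q/a) · arctan σ_q`. -/
def integrandPhase (χ : ℝ → ℝ) (q : Heis) (a : ℝ) (P : LegendrianGrassmannian) : ℝ :=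
  2 * phiAt q P.1 / gaugeAt q P.1 ^ 3 * (a⁻¹ * deriv χ (gaugeAt q P.1 / a)) * arctanPhaseAt q P.1

/-- The integrand `𝔯_q⁴ ∇^𝒫 arctan σ_q · ∇^𝒫 [𝔯_q⁻³ a⁻¹ χ'(𝔯_q/a) arctan σ_q]`. -/
def integrandCross (χ : ℝ → ℝ) (q : Heis) (a : ℝ) (P : LegendrianGrassmannian) : ℝ :=
  gaugeAt q P.1 ^ 4 * (tGrad (arctanPhaseAt q) P ⬝ᵥ
    tGrad (fun x => (gaugeAt q x ^ 3)⁻¹ * (a⁻¹ * deriv χ (gaugeAt q x / a)) * arctanPhaseAt q x) P)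

/-- The quantity `Θ^χ(q, a)` of the varifold `v`. -/
def Theta (χ : ℝ → ℝ) (v : Measure LegendrianGrassmannian) (q : Heis) (a : ℝ) : ℝ :=
  -(∫ P, integrandGauge χ q a P ∂v) - (∫ P, integrandPhase χ q a P ∂v)
    + (1 / 4) * ∫ P, integrandCross χ q a P ∂v

/-- The quantity `-ε⁻¹ ∫ χ'(𝔯_q/ε) [|∇^𝒫 𝔯_q|² / 𝔯_q + 2 φ_q / 𝔯_q³ · arctan σ_q] dv`, whose limit as
`ε → 0` is the density `θ^χ(q)`. -/
def preDensity (χ : ℝ → ℝ) (v : Measure LegendrianGrassmannian) (q : Heis) (ε : ℝ) : ℝ :=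
  -(1 / ε) * ∫ P, deriv χ (gaugeAt q P.1 / ε) *
    ((tGrad (gaugeAt q) P ⬝ᵥ tGrad (gaugeAt q) P) / gaugeAt q P.1
      + 2 * phiAt q P.1 / gaugeAt q P.1 ^ 3 * arctanPhaseAt q P.1) ∂v

end Heisenberg

end

noncomputable section

namespace Heisenberg

/-! Write R = ρ² and Φ = 2φ, both centred at q, so that 𝔯⁴ = R² + Φ² and arctan σ is the argument of
R + iΦ. The Hamiltonian field generated by arctan σ has tangential divergence -|∇^𝒫 arctan σ|² on
every Legendrian plane. Testing stationarity with χ(𝔯/b) arctan σ would therefore equate the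
weighted energy of arctan σ with terms supported where χ' ≠ 0. But arctan σ is discontinuous at q,
so the admissible test function is χ(𝔯/b) arg(R + ε + iΦ) with ε > 0.

The divergence of that field is `boundaryTerm` minus χ times `phaseEnergy` (`tDiv_testFunction`).
The regularized energy equals |∇^𝒫 arg(R + ε + iΦ)|² + 2ε / |R + ε + iΦ|², hence is still
nonnegative. At ε = 0 the boundary term is pointwise the integrand of Θ^χ (`integrandCross_eq`), and
it is bounded by a multiple of b⁻² uniformly in ε. So Θ^χ(q, b) is the limit of nonnegative
integrals. The energy may concentrate at q in this limit, but the difference of two cut-offs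
vanishes near q, which gives the exact identity `Theta_sub_Theta`: Θ^χ(q, b) - Θ^χ(q, a) is the
integral of (χ(𝔯/b) - χ(𝔯/a)) |∇^𝒫 arctan σ|². Monotonicity, the limit θ, and the energy bound
follow; the annulus estimate is the uniform bound on the boundary term.

It remains to see that the cross term of Θ^χ disappears as a → 0. Since -χ' = η² and χ'' = -2ηη',
every summand of that term carries a factor η. Cauchy–Schwarz bounds the term by δ times the
integrand of the density plus M/δ times the energy on a < 𝔯 < 2a. The latter is at most Θ^χ(q, 2a) -
Θ^χ(q, a/2), which tends to 0 because Θ^χ has a limit (`exists_abs_integrandCross_le`,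
`tendsto_of_abs_sub_le_mul_add`). -/

/-! ### Linear algebra of Lagrangian planes -/

/-- The bilinear form `(v, w) ↦ ⟨v, M w⟩` of the orthogonal projection `M` onto a plane. -/
def planeForm (M : LagrangianPlane) (v w : Fin 4 → ℝ) : ℝ := v ⬝ᵥ (M.1 *ᵥ w)

/-- The matrix of the complex structure `mulI`. -/
def mulIMatrix : Matrix (Fin 4) (Fin 4) ℝ :=
  !![0, -1, 0, 0; 1, 0, 0, 0; 0, 0, 0, -1; 0, 0, 1, 0]

lemma mulI_eq_mulVec (v : Fin 4 → ℝ) : mulI v = mulIMatrix *ᵥ v := by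
  ext i
  fin_cases i <;> simp [mulI, mulIMatrix, Matrix.mulVec, dotProduct, Fin.sum_univ_four]

lemma mulIMatrix_transpose : mulIMatrixᵀ = -mulIMatrix := by
  ext i j
  fin_cases i <;> fin_cases j <;> simp [mulIMatrix]

lemma mulIMatrix_mul_self : mulIMatrix * mulIMatrix = -1 := by
  ext i j
  fin_cases i <;> fin_cases j <;> simp [mulIMatrix, Matrix.mul_apply, Fin.sum_univ_four]

namespace LagrangianPlane

variable (M : LagrangianPlane)

lemma symm_apply (i j : Fin 4) : M.1 i j = M.1 j i := by
  conv_lhs => rw [← M.2.1]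
  rfl

lemma mul_mulI_mul : M.1 * mulIMatrix * M.1 = 0 := by
  have h := M.2.2.2.2
  have key : ∀ v w : Fin 4 → ℝ, w ⬝ᵥ ((M.1 * mulIMatrix * M.1) *ᵥ v) = 0 := by
    intro v w
    have h1 := h v w
    rw [mulI_eq_mulVec, dotProduct_comm] at h1
    refine Eq.trans ?_ h1
    rw [← Matrix.mulVec_mulVec, ← Matrix.mulVec_mulVec,
      Matrix.dotProduct_mulVec w, ← Matrix.mulVec_transpose, M.2.1]
  ext i j
  have := key (Pi.single j 1) (Pi.single i 1)
  simpa using this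

/-- For a Lagrangian plane, multiplication by i is an isometry onto the orthogonal complement. The
matrix `Z` below is the projection onto what the plane and its image leave uncovered: it is
symmetric, idempotent, and of trace -2 - 2 + 4 = 0, so its Hilbert–Schmidt norm vanishes. -/
lemma conj_mulI : mulIMatrix * M.1 * mulIMatrix = M.1 - 1 := by
  obtain ⟨hT, hI, htr, -⟩ := M.2
  set A := M.1 with hA
  set J := mulIMatrix with hJ
  have hJT : Jᵀ = -J := mulIMatrix_transpose
  have hJJ : J * J = -1 := mulIMatrix_mul_self
  have h0 : A * J * A = 0 := mul_mulI_mul M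
  set Z := J * A * J - A + 1 with hZ
  have hZT : Zᵀ = Z := by
    simp [hZ, Matrix.transpose_mul, hT, hJT, Matrix.mul_assoc]
  have e1 : J * A * J * (J * A * J) = -(J * A * J) := by
    calc J * A * J * (J * A * J) = J * A * (J * J) * A * J := by noncomm_ring
      _ = -(J * (A * A) * J) := by rw [hJJ]; noncomm_ring
      _ = _ := by rw [hI]
  have e2 : J * A * J * A = 0 := by
    calc J * A * J * A = J * (A * J * A) := by noncomm_ring
      _ = 0 := by rw [h0]; simp
  have e3 : A * (J * A * J) = 0 := by
    calc A * (J * A * J) = (A * J * A) * J := by noncomm_ring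
      _ = 0 := by rw [h0]; simp
  have hZZ : Z * Z = Z := by
    have : Z * Z = J * A * J * (J * A * J) - J * A * J * A - A * (J * A * J) + A * A
        + (J * A * J - A) + (J * A * J - A) + 1 := by
      rw [hZ]; noncomm_ring
    rw [this, e1, e2, e3, hI, hZ]; noncomm_ring
  have htrZ : Z.trace = 0 := by
    have : (J * A * J).trace = -A.trace := by
      rw [Matrix.mul_assoc, Matrix.trace_mul_comm, Matrix.mul_assoc, hJJ]; simp
    rw [hZ, Matrix.trace_add, Matrix.trace_sub, this, htr, Matrix.trace_one]
    norm_num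
  have hz : Z = 0 := by
    have h2 : (Zᴴ * Z).trace = 0 := by
      have : Zᴴ = Z := by rw [Matrix.conjTranspose_eq_transpose_of_trivial, hZT]
      rw [this, hZZ, htrZ]
    exact Matrix.trace_conjTranspose_mul_self_eq_zero_iff.mp h2
  have : J * A * J = Z + (A - 1) := by rw [hZ]; abel
  rw [this, hz, zero_add]

lemma mulVec_dotProduct (v w : Fin 4 → ℝ) : (M.1 *ᵥ v) ⬝ᵥ w = planeForm M v w := by
  rw [planeForm, Matrix.dotProduct_mulVec, ← Matrix.mulVec_transpose, M.2.1]

lemma mulVec_dotProduct_mulVec (v w : Fin 4 → ℝ) :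
    (M.1 *ᵥ v) ⬝ᵥ (M.1 *ᵥ w) = planeForm M v w := by
  rw [mulVec_dotProduct, planeForm, Matrix.mulVec_mulVec, M.2.2.1, planeForm]

lemma planeForm_comm (v w : Fin 4 → ℝ) : planeForm M v w = planeForm M w v := by
  rw [← mulVec_dotProduct, dotProduct_comm, planeForm]

lemma planeForm_self_nonneg (v : Fin 4 → ℝ) : 0 ≤ planeForm M v v := by
  rw [← mulVec_dotProduct_mulVec]
  exact Finset.sum_nonneg fun i _ => mul_self_nonneg _

lemma planeForm_sq_le (v w : Fin 4 → ℝ) :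
    planeForm M v w ^ 2 ≤ planeForm M v v * planeForm M w w := by
  simp only [← mulVec_dotProduct_mulVec, dotProduct, ← sq]
  exact Finset.sum_mul_sq_le_sq_mul_sq _ _ _

lemma planeForm_combination (a b c d : ℝ) (v w : Fin 4 → ℝ) :
    planeForm M (a • v + b • w) (c • v + d • w) =
      a * c * planeForm M v v + (a * d + b * c) * planeForm M v w + b * d * planeForm M w w := by
  have h := planeForm_comm M w v
  simp only [planeForm, Matrix.mulVec_add, Matrix.mulVec_smul, dotProduct_add, add_dotProduct,
    smul_dotProduct, dotProduct_smul, smul_eq_mul] at h ⊢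
  rw [h]; ring

lemma planeForm_mulI (v w : Fin 4 → ℝ) :
    planeForm M (mulI v) (mulI w) = v ⬝ᵥ w - planeForm M v w := by
  have h : planeForm M (mulI v) (mulI w) = -(v ⬝ᵥ ((mulIMatrix * M.1 * mulIMatrix) *ᵥ w)) := by
    rw [planeForm, mulI_eq_mulVec, mulI_eq_mulVec, ← Matrix.mulVec_mulVec, ← Matrix.mulVec_mulVec,
      Matrix.dotProduct_mulVec v, ← Matrix.mulVec_transpose, mulIMatrix_transpose,
      Matrix.neg_mulVec, neg_dotProduct, neg_neg]
  rw [h, conj_mulI, Matrix.sub_mulVec, Matrix.one_mulVec, dotProduct_sub, planeForm]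
  ring

/-- A symmetric idempotent satisfies Mᵢᵢ = ∑ⱼ Mᵢⱼ². This is the boundedness behind compactness of
the Grassmannian, which in turn gives finite mass over compact sets of base points. -/
lemma abs_apply_le_one (i j : Fin 4) : |M.1 i j| ≤ 1 := by
  have h : ∀ i, M.1 i i = ∑ j, M.1 i j ^ 2 := by
    intro i
    have h1 := congrFun (congrFun M.2.2.1 i) i
    rw [Matrix.mul_apply] at h1
    rw [← h1]
    exact Finset.sum_congr rfl fun j _ => by rw [symm_apply M j i, sq]
  have h2 : ∀ j, M.1 i j ^ 2 ≤ M.1 i i := fun j => by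
    rw [h i]
    exact Finset.single_le_sum (f := fun j => M.1 i j ^ 2) (fun _ _ => sq_nonneg _)
      (Finset.mem_univ j)
  have h3 : M.1 i i ≤ 1 := by
    have := h2 i
    nlinarith
  rw [← sq_le_one_iff_abs_le_one]
  exact (h2 j).trans h3

lemma continuous_planeForm {X : Type*} [TopologicalSpace X] {f : X → LagrangianPlane}
    {g h : X → Fin 4 → ℝ} (hf : Continuous f) (hg : Continuous g) (hh : Continuous h) :
    Continuous fun x => planeForm (f x) (g x) (h x) :=
  hg.dotProduct ((continuous_subtype_val.comp hf).matrix_mulVec hh)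

end LagrangianPlane

instance : CompactSpace LagrangianPlane := by
  refine isCompact_iff_compactSpace.mp ?_
  have hK : IsCompact (Set.pi univ fun _ : Fin 4 => Set.pi univ fun _ : Fin 4 => Icc (-1 : ℝ) 1) :=
    isCompact_univ_pi fun _ => isCompact_univ_pi fun _ => isCompact_Icc
  refine hK.of_isClosed_subset ?_ ?_
  · have hS : ∀ p : Matrix (Fin 4) (Fin 4) ℝ → Prop, IsClosed {M | p M} → IsClosed (Set.ofPred p) := fun _ h => h
    refine hS _ ?_
    simp only [ofPred_and, ofPred_forall]
    have hc : Continuous fun M : Matrix (Fin 4) (Fin 4) ℝ => M := continuous_id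
    refine (isClosed_eq hc.matrix_transpose hc).inter
      ((isClosed_eq (hc.matrix_mul hc) hc).inter
      ((isClosed_eq hc.matrix_trace continuous_const).inter
      (isClosed_iInter fun v => isClosed_iInter fun w => isClosed_eq ?_ continuous_const)))
    simp only [mulI_eq_mulVec]
    exact (continuous_const.matrix_mulVec (hc.matrix_mulVec continuous_const)).dotProduct
      (hc.matrix_mulVec continuous_const)
  · intro M hM i _ j _
    exact abs_le.mp (LagrangianPlane.abs_apply_le_one ⟨M, hM⟩ i j)

/-! ### The divergence of a Hamiltonian vector field -/

lemma frame_fst (p : Heis) (i : Fin 4) : (frame p i).1 = Pi.single i 1 := by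
  ext j
  fin_cases i <;> fin_cases j <;> simp [frame]

lemma contactForm_frame (p : Heis) (i : Fin 4) : contactForm p (frame p i) = 0 := by
  fin_cases i <;> simp [frame, contactForm]

lemma hamField_fst (F : Heis → ℝ) (p : Heis) :
    (hamField F p).1 = (1 / 2 : ℝ) • mulI (hGrad F p) := by
  ext j
  simp only [hamField, Prod.smul_fst, Prod.fst_sub, Prod.fst_sum, frame_fst, Pi.smul_apply,
    Finset.sum_apply, smul_zero, sub_zero, smul_eq_mul,
    Pi.single_apply]
  simp

lemma contactForm_hamField (F : Heis → ℝ) (p : Heis) : contactForm p (hamField F p) = F p := by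
  simp [hamField, contactForm, frame, Fin.sum_univ_four]
  ring

/-- The differential of `x ↦ α_x(v)` applied to `u`. -/
def contactFormDeriv (u v : Heis) : ℝ :=
  (u.1 0 * v.1 1 - u.1 1 * v.1 0) + (u.1 2 * v.1 3 - u.1 3 * v.1 2)

lemma hasFDerivAt_coord (i : Fin 4) (p : Heis) :
    HasFDerivAt (fun x : Heis => x.1 i)
      ((ContinuousLinearMap.proj i).comp (ContinuousLinearMap.fst ℝ (Fin 4 → ℝ) ℝ)) p :=
  ((ContinuousLinearMap.proj (R := ℝ) (φ := fun _ : Fin 4 => ℝ) i).comp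
    (ContinuousLinearMap.fst ℝ (Fin 4 → ℝ) ℝ)).hasFDerivAt

lemma metricDeriv_eq (p u v w : Heis) :
    metricDeriv p u v w = contactFormDeriv u v * contactForm p w
      + contactForm p v * contactFormDeriv u w := by
  have hα : ∀ v : Heis, HasFDerivAt (fun x : Heis => contactForm x v)
      (v.1 1 • ((ContinuousLinearMap.proj 0).comp (ContinuousLinearMap.fst ℝ (Fin 4 → ℝ) ℝ))
      - v.1 0 • ((ContinuousLinearMap.proj 1).comp (ContinuousLinearMap.fst ℝ (Fin 4 → ℝ) ℝ))
      + (v.1 3 • ((ContinuousLinearMap.proj 2).comp (ContinuousLinearMap.fst ℝ (Fin 4 → ℝ) ℝ))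
      - v.1 2 • ((ContinuousLinearMap.proj 3).comp (ContinuousLinearMap.fst ℝ (Fin 4 → ℝ) ℝ)))) p := by
    intro v
    have h := fun i => hasFDerivAt_coord i p
    refine ((((h 0).mul_const (v.1 1)).sub ((h 1).mul_const (v.1 0))).const_add (-v.2)).add
      (((h 2).mul_const (v.1 3)).sub ((h 3).mul_const (v.1 2)))
  have := ((hα v).mul (hα w)).const_add (v.1 ⬝ᵥ w.1)
  unfold metricDeriv metric
  refine (congrArg (fun L : Heis →L[ℝ] ℝ => L u) this.fderiv).trans ?_
  simp [contactFormDeriv]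
  ring

lemma contDiff_frame (i : Fin 4) : ContDiff ℝ ∞ fun p : Heis => frame p i := by
  have h : ∀ i, ContDiff ℝ ∞ fun p : Heis => p.1 i := fun i => by fun_prop
  fin_cases i
  · exact contDiff_const.prodMk (h 1).neg
  · exact contDiff_const.prodMk (h 0)
  · exact contDiff_const.prodMk (h 3).neg
  · exact contDiff_const.prodMk (h 2)

lemma contDiff_hGrad {F : Heis → ℝ} (hF : ContDiff ℝ ∞ F) (i : Fin 4) :
    ContDiff ℝ ∞ fun p => hGrad F p i :=
  (hF.fderiv_right (m := ∞) le_rfl).clm_apply (contDiff_frame i)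

lemma contDiff_mulI_hGrad {F : Heis → ℝ} (hF : ContDiff ℝ ∞ F) (i : Fin 4) :
    ContDiff ℝ ∞ fun p => mulI (hGrad F p) i := by
  have h := fun i => contDiff_hGrad hF i
  fin_cases i
  · exact (h 1).neg
  · exact h 0
  · exact (h 3).neg
  · exact h 2

lemma contDiff_hamField {F : Heis → ℝ} (hF : ContDiff ℝ ∞ F) : ContDiff ℝ ∞ (hamField F) := by
  refine ContDiff.const_smul _ (ContDiff.sub (ContDiff.sum fun i _ => ?_) ?_)
  · exact (contDiff_mulI_hGrad hF i).smul (contDiff_frame i)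
  · exact (contDiff_const.mul hF).smul contDiff_const

/-- Only the horizontal part of W_F survives. As α(W_F) = F and α kills the frame, the Christoffel
terms reduce to F times half of dα on pairs of frame vectors, which is antisymmetric and traces to
zero against the symmetric `M`. -/
theorem tDiv_hamField {F : Heis → ℝ} (hF : ContDiff ℝ ∞ F) (P : LegendrianGrassmannian) :
    tDiv (hamField F) P = (1 / 2) * ∑ i, ∑ j, P.2.1 i j *
      fderiv ℝ (fun y => mulI (hGrad F y) j) P.1 (frame P.1 i) := by
  obtain ⟨p, M⟩ := P
  have hW : HasFDerivAt (hamField F) (fderiv ℝ (hamField F) p) p :=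
    ((contDiff_hamField hF).differentiable (by simp) p).hasFDerivAt
  have hcov : ∀ i j, covDerivInner (hamField F) p (frame p i) (frame p j) =
      (1 / 2) * fderiv ℝ (fun y => mulI (hGrad F y) j) p (frame p i)
        + F p * contactFormDeriv (frame p i) (frame p j) := by
    intro i j
    have h1 : (fderiv ℝ (hamField F) p (frame p i)).1 j =
        (1 / 2) * fderiv ℝ (fun y => mulI (hGrad F y) j) p (frame p i) := by
      have h2 := (hasFDerivAt_coord j (hamField F p)).comp p hW
      have h3 : HasFDerivAt (fun y => (1 / 2 : ℝ) * mulI (hGrad F y) j)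
          ((1 / 2 : ℝ) • fderiv ℝ (fun y => mulI (hGrad F y) j) p) p :=
        (((contDiff_mulI_hGrad hF j).differentiable (by simp) p).hasFDerivAt).const_mul _
      have h4 : (fun x : Heis => x.1 j) ∘ hamField F = fun y => (1 / 2 : ℝ) * mulI (hGrad F y) j := by
        funext y
        simp [hamField_fst]
      rw [h4] at h2
      simpa using congrArg (fun L : Heis →L[ℝ] ℝ => L (frame p i)) (h2.unique h3)
    have hanti : contactFormDeriv (frame p j) (frame p i)
        = - contactFormDeriv (frame p i) (frame p j) := by
      simp only [contactFormDeriv]; ring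
    rw [covDerivInner, metric, contactForm_frame, metricDeriv_eq, metricDeriv_eq, metricDeriv_eq,
      contactForm_frame, contactForm_frame, contactForm_hamField, hanti, frame_fst p j,
      dotProduct_single_one, h1]
    ring
  have hcancel : ∑ i, ∑ j, M.1 i j * (F p * contactFormDeriv (frame p i) (frame p j)) = 0 := by
    have h := M.symm_apply
    simp only [Fin.sum_univ_four, contactFormDeriv, frame_fst]
    simp [h 1 0, h 3 2]
  simp only [tDiv, hcov, mul_add, Finset.sum_add_distrib, hcancel, add_zero]
  simp only [Finset.mul_sum]
  exact Finset.sum_congr rfl fun i _ => Finset.sum_congr rfl fun j _ => by ring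

section

/-! ### Functions of `|z|²` and `2φ` around a point -/

/-- The horizontal part of `q⁻¹ * x`. -/
def disp (q x : Heis) : Fin 4 → ℝ := x.1 - q.1

/-- The function `ρ²` centered at `q`. -/
def sqNorm (q x : Heis) : ℝ := rhoSq (mul (inv q) x)

/-- The function `2φ` centered at `q`. -/
def height (q x : Heis) : ℝ := 2 * phiAt q x

/-- The `i`-th horizontal coordinate as a linear form. -/
def coordCLM (i : Fin 4) : Heis →L[ℝ] ℝ :=
  (ContinuousLinearMap.proj i).comp (ContinuousLinearMap.fst ℝ (Fin 4 → ℝ) ℝ)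

@[simp] lemma coordCLM_apply (i : Fin 4) (v : Heis) : coordCLM i v = v.1 i := rfl

/-- The differential of `sqNorm q` at `x`. -/
def dSqNorm (q x : Heis) : Heis →L[ℝ] ℝ := ∑ i, (2 * disp q x i) • coordCLM i

/-- The differential of `height q`, which is an affine function. -/
def dHeight (q : Heis) : Heis →L[ℝ] ℝ :=
  (2 : ℝ) • (ContinuousLinearMap.snd ℝ (Fin 4 → ℝ) ℝ - (q.1 0 • coordCLM 1 - q.1 1 • coordCLM 0)
    - (q.1 2 • coordCLM 3 - q.1 3 • coordCLM 2))

lemma sqNorm_eq (q x : Heis) : sqNorm q x = ∑ i, disp q x i ^ 2 := by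
  simp [sqNorm, rhoSq, mul, inv, disp, sub_eq_neg_add]

lemma sqNorm_eq_dotProduct (q x : Heis) : sqNorm q x = disp q x ⬝ᵥ disp q x := by
  simp [sqNorm_eq, dotProduct, sq]

lemma sqNorm_nonneg (q x : Heis) : 0 ≤ sqNorm q x := by
  rw [sqNorm_eq]; positivity

lemma height_eq (q x : Heis) : height q x = 2 * (x.2 - q.2 - (q.1 0 * x.1 1 - q.1 1 * x.1 0)
    - (q.1 2 * x.1 3 - q.1 3 * x.1 2)) := by
  simp [height, phiAt, mul, inv]; ring

lemma dSqNorm_frame (q x : Heis) (i : Fin 4) : dSqNorm q x (frame x i) = 2 * disp q x i := by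
  simp [dSqNorm, frame_fst, Pi.single_apply]

lemma dHeight_frame (q x : Heis) (i : Fin 4) :
    dHeight q (frame x i) = 2 * mulI (disp q x) i := by
  fin_cases i <;> simp [dHeight, frame, mulI, disp] <;> ring

/-- `f` has the differential `f₁ d(sqNorm q) + f₂ d(height q)` at `x`. -/
def HasRHDeriv (q : Heis) (f : Heis → ℝ) (f₁ f₂ : ℝ) (x : Heis) : Prop :=
  HasFDerivAt f (f₁ • dSqNorm q x + f₂ • dHeight q) x

variable {q x : Heis} {f g : Heis → ℝ} {f₁ f₂ g₁ g₂ : ℝ}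

lemma hasFDerivAt_disp (q x : Heis) (i : Fin 4) :
    HasFDerivAt (fun y => disp q y i) (coordCLM i) x :=
  (coordCLM i).hasFDerivAt.sub_const (q.1 i)

lemma hasRHDeriv_sqNorm (q x : Heis) : HasRHDeriv q (sqNorm q) 1 0 x := by
  have h : HasFDerivAt (fun y => ∑ i, disp q y i ^ 2) (dSqNorm q x) x := by
    refine HasFDerivAt.fun_sum fun i _ => ?_
    simpa using (hasFDerivAt_disp q x i).pow 2
  simpa [HasRHDeriv, ← sqNorm_eq] using h

lemma hasRHDeriv_height (q x : Heis) : HasRHDeriv q (height q) 0 1 x := by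
  have h : height q = fun y => dHeight q y - 2 * q.2 := by
    funext y
    rw [height_eq]
    simp [dHeight]; ring
  rw [HasRHDeriv, h]
  simpa using (dHeight q).hasFDerivAt.sub_const (2 * q.2)

namespace HasRHDeriv

lemma congr_deriv (hf : HasRHDeriv q f f₁ f₂ x) (h₁ : f₁ = g₁) (h₂ : f₂ = g₂) :
    HasRHDeriv q f g₁ g₂ x := h₁ ▸ h₂ ▸ hf

lemma congr_of_eventuallyEq (hf : HasRHDeriv q f f₁ f₂ x) (h : g =ᶠ[𝓝 x] f) :
    HasRHDeriv q g f₁ f₂ x := HasFDerivAt.congr_of_eventuallyEq hf h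

lemma const (c : ℝ) : HasRHDeriv q (fun _ => c) 0 0 x := by
  simpa [HasRHDeriv] using hasFDerivAt_const c x

lemma add (hf : HasRHDeriv q f f₁ f₂ x) (hg : HasRHDeriv q g g₁ g₂ x) :
    HasRHDeriv q (fun y => f y + g y) (f₁ + g₁) (f₂ + g₂) x :=
  (HasFDerivAt.fun_add hf hg).congr_fderiv (by module)

lemma mul (hf : HasRHDeriv q f f₁ f₂ x) (hg : HasRHDeriv q g g₁ g₂ x) :
    HasRHDeriv q (fun y => f y * g y) (f₁ * g x + f x * g₁) (f₂ * g x + f x * g₂) x :=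
  (HasFDerivAt.fun_mul hf hg).congr_fderiv (by module)

lemma comp {h : ℝ → ℝ} {h' : ℝ} (hh : HasDerivAt h h' (f x)) (hf : HasRHDeriv q f f₁ f₂ x) :
    HasRHDeriv q (fun y => h (f y)) (h' * f₁) (h' * f₂) x :=
  (hh.comp_hasFDerivAt x hf).congr_fderiv (by module)

lemma hGrad_eq (hf : HasRHDeriv q f f₁ f₂ x) :
    hGrad f x = (2 * f₁) • disp q x + (2 * f₂) • mulI (disp q x) := by
  ext i
  rw [hGrad, HasFDerivAt.fderiv hf]
  simp [dSqNorm_frame, dHeight_frame]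
  ring

/-- The horizontal gradients of R and Φ are 2z and 2iz, with z the displacement from q. Since the
plane is Lagrangian, the projection of iz has squared length |z|² minus that of z. So all products
of such gradients depend on the plane through two numbers only. -/
lemma tGrad_dotProduct_tGrad {P : LegendrianGrassmannian} (hf : HasRHDeriv q f f₁ f₂ P.1)
    (hg : HasRHDeriv q g g₁ g₂ P.1) :
    tGrad f P ⬝ᵥ tGrad g P =
      4 * (f₁ * g₁ * planeForm P.2 (disp q P.1) (disp q P.1)
        + (f₁ * g₂ + f₂ * g₁) * planeForm P.2 (disp q P.1) (mulI (disp q P.1))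
        + f₂ * g₂ * (sqNorm q P.1 - planeForm P.2 (disp q P.1) (disp q P.1))) := by
  rw [tGrad, tGrad, LagrangianPlane.mulVec_dotProduct_mulVec, hf.hGrad_eq, hg.hGrad_eq,
    LagrangianPlane.planeForm_combination, LagrangianPlane.planeForm_mulI, sqNorm_eq_dotProduct]
  ring

end HasRHDeriv

lemma mulI_smul_add_smul_mulI (a b : ℝ) (v : Fin 4 → ℝ) :
    mulI (a • v + b • mulI v) = a • mulI v - b • v := by
  ext i
  fin_cases i <;> simp [mulI] <;> ring

lemma hasFDerivAt_mulI_disp (q x : Heis) (j : Fin 4) :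
    HasFDerivAt (fun y => mulI (disp q y) j) (∑ l, mulIMatrix j l • coordCLM l) x := by
  have h : (fun y => mulI (disp q y) j) = fun y => ∑ l, mulIMatrix j l * disp q y l := by
    funext y
    rw [mulI_eq_mulVec]; rfl
  rw [h]
  exact HasFDerivAt.fun_sum fun l _ => (hasFDerivAt_disp q x l).const_mul _

/-- For F a function of R and Φ with partial derivatives a and b, J∇^H F = 2a·iz - 2b·z.
Differentiating the coefficients gives quadratic terms in z and iz; differentiating the vectors
gives tr(MJ) = 0 and tr M = 2, whence the isolated `b P.1`. -/
theorem tDiv_hamField_of_hasRHDeriv {F a b : Heis → ℝ} {a₁ a₂ b₁ b₂ : ℝ}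
    {P : LegendrianGrassmannian} (hF : ContDiff ℝ ∞ F)
    (hd : ∀ y, HasRHDeriv q F (a y) (b y) y) (ha : HasRHDeriv q a a₁ a₂ P.1)
    (hb : HasRHDeriv q b b₁ b₂ P.1) :
    tDiv (hamField F) P =
      2 * (planeForm P.2 (disp q P.1) (mulI (disp q P.1)) * (a₁ - b₂)
        + (sqNorm q P.1 - planeForm P.2 (disp q P.1) (disp q P.1)) * a₂
        - planeForm P.2 (disp q P.1) (disp q P.1) * b₁ - b P.1) := by
  obtain ⟨p, M⟩ := P
  have hgrad : ∀ j, (fun y => mulI (hGrad F y) j) =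
      fun y => 2 * a y * mulI (disp q y) j - 2 * b y * disp q y j := by
    intro j
    funext y
    rw [(hd y).hGrad_eq, mulI_smul_add_smul_mulI]
    rfl
  have hder : ∀ i j, fderiv ℝ (fun y => mulI (hGrad F y) j) p (frame p i) =
      4 * (a₁ * disp q p i + a₂ * mulI (disp q p) i) * mulI (disp q p) j
      - 4 * (b₁ * disp q p i + b₂ * mulI (disp q p) i) * disp q p j
      + 2 * a p * mulIMatrix j i - 2 * b p * (1 : Matrix (Fin 4) (Fin 4) ℝ) j i := by
    intro i j
    have h1 := (HasFDerivAt.const_mul ha 2).fun_mul (hasFDerivAt_mulI_disp q p j)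
    have h2 := (HasFDerivAt.const_mul hb 2).fun_mul (hasFDerivAt_disp q p j)
    rw [hgrad, (h1.fun_sub h2).fderiv]
    simp [dSqNorm_frame, dHeight_frame, frame_fst, Pi.single_apply, Matrix.one_apply]
    ring
  have hsum : ∀ v w : Fin 4 → ℝ, ∑ i, ∑ j, M.1 i j * (v i * w j) = planeForm M v w := by
    intro v w
    simp only [planeForm, dotProduct, Matrix.mulVec, Finset.mul_sum]
    exact Finset.sum_congr rfl fun i _ => Finset.sum_congr rfl fun j _ => by ring
  have htr1 : ∑ i, ∑ j, M.1 i j * (1 : Matrix (Fin 4) (Fin 4) ℝ) j i = 2 := by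
    refine Eq.trans ?_ M.2.2.2.1
    simp [Matrix.one_apply, Matrix.trace]
  have htr2 : ∑ i, ∑ j, M.1 i j * mulIMatrix j i = 0 := by
    have h := M.symm_apply
    simp [Fin.sum_univ_four, mulIMatrix, h 1 0, h 3 2]
  have hsplit : ∑ i, ∑ j, M.1 i j * fderiv ℝ (fun y => mulI (hGrad F y) j) p (frame p i) =
      4 * a₁ * ∑ i, ∑ j, M.1 i j * (disp q p i * mulI (disp q p) j)
      + 4 * a₂ * ∑ i, ∑ j, M.1 i j * (mulI (disp q p) i * mulI (disp q p) j)
      - 4 * b₁ * ∑ i, ∑ j, M.1 i j * (disp q p i * disp q p j)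
      - 4 * b₂ * ∑ i, ∑ j, M.1 i j * (mulI (disp q p) i * disp q p j)
      + 2 * a p * ∑ i, ∑ j, M.1 i j * mulIMatrix j i
      - 2 * b p * ∑ i, ∑ j, M.1 i j * (1 : Matrix (Fin 4) (Fin 4) ℝ) j i := by
    simp only [Finset.mul_sum, ← Finset.sum_add_distrib, ← Finset.sum_sub_distrib, hder]
    exact Finset.sum_congr rfl fun i _ => Finset.sum_congr rfl fun j _ => by ring
  rw [tDiv_hamField hF]
  dsimp only
  rw [hsplit, htr1, htr2, hsum, hsum, hsum, hsum, LagrangianPlane.planeForm_mulI,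
    LagrangianPlane.planeForm_comm M (mulI _), ← sqNorm_eq_dotProduct]
  ring

end

section

variable {q x : Heis} {f g : Heis → ℝ} {f₁ f₂ g₁ g₂ : ℝ}

/-! ### The gauge -/

lemma gaugeAt_eq (q x : Heis) :
    gaugeAt q x = (sqNorm q x ^ 2 + height q x ^ 2) ^ (1 / 4 : ℝ) := by
  simp only [gaugeAt, gauge, sqNorm, height, phiAt]
  congr 1; ring

lemma gaugeAt_nonneg (q x : Heis) : 0 ≤ gaugeAt q x := by
  rw [gaugeAt_eq]; positivity

lemma gaugeAt_pow_four (q x : Heis) : gaugeAt q x ^ 4 = sqNorm q x ^ 2 + height q x ^ 2 := by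
  rw [gaugeAt_eq, ← Real.rpow_natCast, ← Real.rpow_mul (by positivity)]
  norm_num

lemma sqNorm_le_gaugeAt_sq (q x : Heis) : sqNorm q x ≤ gaugeAt q x ^ 2 := by
  refine le_of_abs_le (abs_le_of_sq_le_sq ?_ (by positivity))
  nlinarith [gaugeAt_pow_four q x, sq_nonneg (height q x)]

lemma abs_height_le_gaugeAt_sq (q x : Heis) : |height q x| ≤ gaugeAt q x ^ 2 := by
  refine abs_le_of_sq_le_sq ?_ (by positivity)
  nlinarith [gaugeAt_pow_four q x, sq_nonneg (sqNorm q x)]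

lemma contDiff_sqNorm (q : Heis) : ContDiff ℝ ∞ (sqNorm q) := by
  have : sqNorm q = fun x => ∑ i, (x.1 i - q.1 i) ^ 2 := by
    funext x; exact sqNorm_eq q x
  rw [this]; fun_prop

lemma contDiff_height (q : Heis) : ContDiff ℝ ∞ (height q) := by
  have : height q = fun x => 2 * (x.2 - q.2 - (q.1 0 * x.1 1 - q.1 1 * x.1 0)
    - (q.1 2 * x.1 3 - q.1 3 * x.1 2)) := by
    funext x; exact height_eq q x
  rw [this]; fun_prop

@[fun_prop] lemma continuous_sqNorm (q : Heis) : Continuous (sqNorm q) :=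
  (contDiff_sqNorm q).continuous

@[fun_prop] lemma continuous_height (q : Heis) : Continuous (height q) :=
  (contDiff_height q).continuous

@[fun_prop] lemma continuous_gaugeAt (q : Heis) : Continuous (gaugeAt q) := by
  have : gaugeAt q = fun x => (sqNorm q x ^ 2 + height q x ^ 2) ^ (1 / 4 : ℝ) := by
    funext x; exact gaugeAt_eq q x
  rw [this]
  exact Continuous.rpow_const (by fun_prop) fun _ => Or.inr (by norm_num)

lemma sq_add_sq_pos (h : 0 < gaugeAt q x) : 0 < sqNorm q x ^ 2 + height q x ^ 2 := by
  rw [← gaugeAt_pow_four]; positivity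

lemma contDiffAt_gaugeAt (h : 0 < gaugeAt q x) : ContDiffAt ℝ ∞ (gaugeAt q) x := by
  have : gaugeAt q = fun x => (sqNorm q x ^ 2 + height q x ^ 2) ^ (1 / 4 : ℝ) := by
    funext x; exact gaugeAt_eq q x
  rw [this]
  exact ((((contDiff_sqNorm q).pow 2).add ((contDiff_height q).pow 2)).contDiffAt).rpow_const_of_ne
    (sq_add_sq_pos h).ne'

lemma hasRHDeriv_gaugeAt (h : 0 < gaugeAt q x) :
    HasRHDeriv q (gaugeAt q) (sqNorm q x / (2 * gaugeAt q x ^ 3))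
      (height q x / (2 * gaugeAt q x ^ 3)) x := by
  have hN := sq_add_sq_pos h
  have e : gaugeAt q = fun x => (sqNorm q x * sqNorm q x + height q x * height q x) ^ (1 / 4 : ℝ) := by
    funext x; rw [gaugeAt_eq, sq, sq]
  have hR := hasRHDeriv_sqNorm q x
  have hH := hasRHDeriv_height q x
  have hpow := Real.hasDerivAt_rpow_const (x := sqNorm q x * sqNorm q x + height q x * height q x)
    (p := 1 / 4) (Or.inl (by nlinarith))
  have hval : (sqNorm q x * sqNorm q x + height q x * height q x) ^ ((1 / 4 : ℝ) - 1)
      = (gaugeAt q x ^ 3)⁻¹ := by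
    rw [gaugeAt_eq, ← Real.rpow_natCast, ← Real.rpow_mul (by positivity),
      ← Real.rpow_neg (by positivity), sq, sq]
    norm_num
  rw [hval] at hpow
  have := HasRHDeriv.comp hpow ((hR.mul hR).add (hH.mul hH))
  rw [e]
  rw [e] at h
  refine this.congr_deriv ?_ ?_ <;> (rw [← e]; field_simp; ring)

lemma isCompact_gaugeAt_le (q : Heis) (s : ℝ) : IsCompact {x | gaugeAt q x ≤ s} := by
  refine Metric.isCompact_of_isClosed_isBounded
    (isClosed_le (continuous_gaugeAt q) continuous_const) ?_
  have hcont : Continuous fun y : Heis => mul q y := by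
    unfold mul; fun_prop
  have hK : IsCompact ((fun y : Heis => mul q y) '' Metric.closedBall 0 (max s (s ^ 2))) :=
    (isCompact_closedBall _ _).image hcont
  refine hK.isBounded.subset fun x hx => ⟨mul (inv q) x, ?_, ?_⟩
  · have hs : 0 ≤ s := (gaugeAt_nonneg q x).trans hx
    have hx2 : gaugeAt q x ^ 2 ≤ s ^ 2 := pow_le_pow_left₀ (gaugeAt_nonneg q x) hx 2
    rw [mem_closedBall_zero_iff, Prod.norm_def]
    refine max_le ((pi_norm_le_iff_of_nonneg (by positivity)).2 fun i => ?_) ?_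
    · refine le_trans ?_ (le_max_left _ _)
      refine abs_le_of_sq_le_sq ?_ hs
      have h1 : (mul (inv q) x).1 i ^ 2 ≤ sqNorm q x :=
        Finset.single_le_sum (f := fun i => (mul (inv q) x).1 i ^ 2) (fun _ _ => sq_nonneg _)
          (Finset.mem_univ i)
      linarith [sqNorm_le_gaugeAt_sq q x]
    · refine le_trans ?_ (le_max_right _ _)
      have h1 : |2 * (mul (inv q) x).2| ≤ gaugeAt q x ^ 2 := abs_height_le_gaugeAt_sq q x
      rw [abs_mul, abs_two] at h1
      rw [Real.norm_eq_abs]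
      linarith [abs_nonneg (mul (inv q) x).2]
  · ext
    · simp [mul, inv]
    · simp [mul, inv]; ring

/-- The gauge is continuous and vanishes only at q, so it has a positive minimum on the compact set
left when `U` is removed from the closed unit gauge ball. This makes the distance from q to the
complement positive. -/
lemma exists_gaugeAt_lt_subset {U : Set Heis} (hU : IsOpen U) (hq : q ∈ U) :
    ∃ δ > 0, ∀ x, gaugeAt q x < δ → x ∈ U := by
  have hK : IsCompact ({x | gaugeAt q x ≤ 1} \ U) := (isCompact_gaugeAt_le q 1).diff hU
  have hpos : ∀ x ∈ {x | gaugeAt q x ≤ 1} \ U, 0 < gaugeAt q x := by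
    intro x hx
    refine lt_of_le_of_ne (gaugeAt_nonneg q x) fun h => hx.2 ?_
    have h0 : sqNorm q x = 0 ∧ height q x = 0 := by
      have h4 := gaugeAt_pow_four q x
      rw [← h] at h4
      constructor <;> nlinarith [sq_nonneg (sqNorm q x), sq_nonneg (height q x)]
    have h1 : x.1 = q.1 := by
      funext i
      have h2 := h0.1
      rw [sqNorm_eq, Finset.sum_eq_zero_iff_of_nonneg fun _ _ => sq_nonneg _] at h2
      have := pow_eq_zero_iff (two_ne_zero) |>.1 (h2 i (Finset.mem_univ i))
      exact sub_eq_zero.1 this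
    have h2 : x.2 = q.2 := by
      have := h0.2
      rw [height_eq, h1] at this
      linarith
    exact (Prod.ext h1 h2 : x = q) ▸ hq
  obtain ⟨δ, hδ, h⟩ : ∃ δ > 0, ∀ x ∈ {x | gaugeAt q x ≤ 1} \ U, δ ≤ gaugeAt q x :=
    hK.exists_forall_le' (continuous_gaugeAt q).continuousOn hpos
  refine ⟨min δ 1, by positivity, fun x hx => by_contra fun hxU => ?_⟩
  exact absurd (h x ⟨(hx.trans_le (min_le_right _ _)).le, hxU⟩)
    (not_le.2 (hx.trans_le (min_le_left _ _)))

/-! ### The regularized phase -/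

/-- The argument of `ρ² + ε + 2iφ`, centered at `q`. For `ε = 0` it is `arctan σ_q`. -/
def phase (q : Heis) (ε : ℝ) (x : Heis) : ℝ := Complex.arg ⟨sqNorm q x + ε, height q x⟩

/-- The squared modulus of `ρ² + ε + 2iφ`, centered at `q`. -/
def modSq (q : Heis) (ε : ℝ) (x : Heis) : ℝ := (sqNorm q x + ε) ^ 2 + height q x ^ 2

/-- The argument absorbs the case distinction on the axis ρ = 0 and shows smoothness across it: off
q, the point R + iΦ lies in the slit plane. At q itself both sides are 0 by the conventions for
`sign` and `arg`. -/
lemma arctanPhaseAt_eq_phase (q : Heis) : arctanPhaseAt q = phase q 0 := by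
  funext x
  have hR := sqNorm_nonneg q x
  change (if sqNorm q x = 0 then _ else Real.arctan (height q x / sqNorm q x)) = _
  rw [phase, add_zero]
  split_ifs with h
  · have e : height q x = 2 * (mul (inv q) x).2 := rfl
    rw [h]
    rcases lt_trichotomy (mul (inv q) x).2 0 with h1 | h1 | h1
    · rw [sign_neg h1, Complex.arg_eq_neg_pi_div_two_iff.2 ⟨rfl, by rw [e]; linarith⟩]
      simp
    · rw [h1, e, h1]; simp [Complex.arg]
    · rw [sign_pos h1, Complex.arg_eq_pi_div_two_iff.2 ⟨rfl, by rw [e]; linarith⟩]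
      simp
  · have hpos : 0 < sqNorm q x := lt_of_le_of_ne hR (Ne.symm h)
    have h1 := Complex.tan_arg ⟨sqNorm q x, height q x⟩
    have h2 := abs_lt.1 (Complex.abs_arg_lt_pi_div_two_iff.2 (Or.inl hpos) :
      |Complex.arg ⟨sqNorm q x, height q x⟩| < _)
    rw [← h1, Real.arctan_tan h2.1 h2.2]

lemma mem_slitPlane {ε : ℝ} (hε : 0 ≤ ε) (h : 0 < gaugeAt q x ∨ 0 < ε) :
    (⟨sqNorm q x + ε, height q x⟩ : ℂ) ∈ Complex.slitPlane := by
  have hR := sqNorm_nonneg q x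
  rw [Complex.mem_slitPlane_iff]
  rcases h with h | h
  · by_cases h1 : height q x = 0
    · left
      have := sq_add_sq_pos h
      have h2 : sqNorm q x ≠ 0 := fun h2 => by simp [h1, h2] at this
      have : 0 < sqNorm q x := lt_of_le_of_ne hR h2.symm
      show 0 < sqNorm q x + ε
      linarith
    · exact Or.inr h1
  · left
    show 0 < sqNorm q x + ε
    linarith

lemma modSq_pos {ε : ℝ} (hε : 0 ≤ ε) (h : 0 < gaugeAt q x ∨ 0 < ε) : 0 < modSq q ε x := by
  have h1 := Complex.slitPlane_ne_zero (mem_slitPlane hε h)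
  have := Complex.normSq_pos.2 h1
  simpa [Complex.normSq_apply, modSq, sq] using this

lemma contDiffAt_phase {ε : ℝ} (hε : 0 ≤ ε) (h : 0 < gaugeAt q x ∨ 0 < ε) :
    ContDiffAt ℝ ∞ (phase q ε) x := by
  have hlog : ContDiffAt ℝ ∞ Complex.log ⟨sqNorm q x + ε, height q x⟩ :=
    (Complex.contDiffAt_log (mem_slitPlane hε h)).restrict_scalars ℝ
  have hW : ContDiffAt ℝ ∞ (fun y => Complex.equivRealProdCLM.symm (sqNorm q y + ε, height q y)) x :=
    Complex.equivRealProdCLM.symm.contDiff.contDiffAt.comp x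
      ((((contDiff_sqNorm q).add contDiff_const).prodMk (contDiff_height q)).contDiffAt)
  have h1 := Complex.imCLM.contDiff.contDiffAt.comp x (ContDiffAt.comp x hlog hW)
  refine h1.congr_of_eventuallyEq (Eventually.of_forall fun y => ?_)
  exact (Complex.log_im _).symm

lemma hasRHDeriv_phase {ε : ℝ} (hε : 0 ≤ ε) (h : 0 < gaugeAt q x ∨ 0 < ε) :
    HasRHDeriv q (phase q ε) (-height q x / modSq q ε x) ((sqNorm q x + ε) / modSq q ε x) x := by
  have hlog := (Complex.hasStrictFDerivAt_log_real (mem_slitPlane hε h)).hasFDerivAt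
  have hW : HasFDerivAt (fun y => Complex.equivRealProdCLM.symm (sqNorm q y + ε, height q y)) _ x :=
    Complex.equivRealProdCLM.symm.toContinuousLinearMap.hasFDerivAt.comp x
      ((HasFDerivAt.add_const ε (hasRHDeriv_sqNorm q x)).prodMk (hasRHDeriv_height q x))
  have h1 := Complex.imCLM.hasFDerivAt.comp x (HasFDerivAt.comp x hlog hW)
  have h2 : phase q ε = Complex.imCLM ∘ Complex.log ∘
      (fun y => Complex.equivRealProdCLM.symm (sqNorm q y + ε, height q y)) := by
    funext y; exact (Complex.log_im _).symm
  rw [HasRHDeriv, h2]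
  refine h1.congr_fderiv ?_
  have hm : (sqNorm q x + ε) * (sqNorm q x + ε) + height q x * height q x = modSq q ε x := by
    rw [modSq]; ring
  have hs : ∀ y : ℝ × ℝ, Complex.equivRealProdCLM.symm y = ⟨y.1, y.2⟩ := fun _ => rfl
  refine ContinuousLinearMap.ext fun v => ?_
  simp [hs, Complex.normSq_apply, hm]
  ring

end

section

variable {q x : Heis}

/-! ### Second derivatives of the regularized phase -/

lemma hasRHDeriv_inv_modSq {ε : ℝ} (hε : 0 ≤ ε) (h : 0 < gaugeAt q x ∨ 0 < ε) :
    HasRHDeriv q (fun y => (modSq q ε y)⁻¹) (-(2 * (sqNorm q x + ε)) / modSq q ε x ^ 2)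
      (-(2 * height q x) / modSq q ε x ^ 2) x := by
  have hm := modSq_pos hε h
  have hS := (hasRHDeriv_sqNorm q x).add (HasRHDeriv.const ε)
  have hH := hasRHDeriv_height q x
  have e : modSq q ε = fun y => (sqNorm q y + ε) * (sqNorm q y + ε) + height q y * height q y := by
    funext y; rw [modSq]; ring
  have h1 := (hS.mul hS).add (hH.mul hH)
  rw [← e] at h1
  refine (HasRHDeriv.comp (hasDerivAt_inv hm.ne') h1).congr_deriv ?_ ?_ <;> field_simp <;> ring

/-- Together with `hasRHDeriv_phase_deriv_snd` this is the Hessian of arg in the variables (R, Φ).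
It is trace-free, because arg is the imaginary part of the holomorphic logarithm. -/
lemma hasRHDeriv_phase_deriv_fst {ε : ℝ} (hε : 0 ≤ ε) (h : 0 < gaugeAt q x ∨ 0 < ε) :
    HasRHDeriv q (fun y => -height q y / modSq q ε y)
      (2 * height q x * (sqNorm q x + ε) / modSq q ε x ^ 2)
      ((height q x ^ 2 - (sqNorm q x + ε) ^ 2) / modSq q ε x ^ 2) x := by
  have hm := modSq_pos hε h
  have h1 := (((HasRHDeriv.const (x := x) (q := q) (-1)).mul (hasRHDeriv_height q x)).mul
    (hasRHDeriv_inv_modSq hε h))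
  have e : (fun y => -1 * height q y * (modSq q ε y)⁻¹) = fun y => -height q y / modSq q ε y := by
    funext y; ring
  rw [e] at h1
  refine h1.congr_deriv ?_ ?_ <;> field_simp
  · ring
  · rw [modSq]; ring

lemma hasRHDeriv_phase_deriv_snd {ε : ℝ} (hε : 0 ≤ ε) (h : 0 < gaugeAt q x ∨ 0 < ε) :
    HasRHDeriv q (fun y => (sqNorm q y + ε) / modSq q ε y)
      ((height q x ^ 2 - (sqNorm q x + ε) ^ 2) / modSq q ε x ^ 2)
      (-(2 * height q x * (sqNorm q x + ε)) / modSq q ε x ^ 2) x := by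
  have hm := modSq_pos hε h
  have h1 := ((hasRHDeriv_sqNorm q x).add (HasRHDeriv.const ε)).mul (hasRHDeriv_inv_modSq hε h)
  have e : (fun y => (sqNorm q y + ε) * (modSq q ε y)⁻¹)
      = fun y => (sqNorm q y + ε) / modSq q ε y := by
    funext y; ring
  rw [e] at h1
  refine h1.congr_deriv ?_ ?_ <;> field_simp
  · rw [modSq]; ring
  · ring

/-! ### Cut-off functions of the gauge -/

namespace IsCutoff

variable {χ : ℝ → ℝ}

lemma differentiable (hχ : IsCutoff χ) : Differentiable ℝ χ := hχ.smooth.differentiable (by simp)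

lemma contDiff_deriv (hχ : IsCutoff χ) : ContDiff ℝ ∞ (deriv χ) :=
  hχ.smooth.deriv'

lemma differentiable_deriv (hχ : IsCutoff χ) : Differentiable ℝ (deriv χ) :=
  hχ.contDiff_deriv.differentiable (by simp)

lemma deriv_nonpos (hχ : IsCutoff χ) (t : ℝ) : deriv χ t ≤ 0 := by
  obtain ⟨η, -, -, -, h⟩ := hχ.neg_deriv_eq_sq
  nlinarith [h t, sq_nonneg (η t)]

lemma antitone (hχ : IsCutoff χ) : Antitone χ :=
  antitone_of_deriv_nonpos hχ.differentiable hχ.deriv_nonpos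

lemma nonneg (hχ : IsCutoff χ) (t : ℝ) : 0 ≤ χ t := by
  rw [← hχ.eq_zero (max t 2) (le_max_right _ _)]
  exact hχ.antitone (le_max_left _ _)

lemma le_one (hχ : IsCutoff χ) (t : ℝ) : χ t ≤ 1 := by
  rw [← hχ.eq_one (min t 1) (min_le_right _ _)]
  exact hχ.antitone (min_le_left _ _)

/-- The point of a smooth square root of -χ' is that χ'' also contains a factor η, so |χ''| ≤ 2K|η|.
The absorption argument for the density rests on this. -/
lemma exists_sqrt (hχ : IsCutoff χ) : ∃ η : ℝ → ℝ, ∃ K : ℝ, 0 ≤ K ∧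
    (∀ t, deriv χ t = -η t ^ 2) ∧ (∀ t, deriv (deriv χ) t = -(2 * η t * deriv η t)) ∧
    (∀ t, |η t| ≤ K ∧ |deriv η t| ≤ K) ∧ ∀ t, t ∉ Ioo 1 2 → η t = 0 ∧ deriv η t = 0 := by
  obtain ⟨η, hη, hc, hs, h⟩ := hχ.neg_deriv_eq_sq
  obtain ⟨K₁, h₁⟩ := hc.exists_bound_of_continuous hη.continuous
  obtain ⟨K₂, h₂⟩ := hc.deriv.exists_bound_of_continuous (hη.continuous_deriv (by simp))
  have e : deriv χ = fun t => -η t ^ 2 := by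
    funext t; linarith [h t]
  refine ⟨η, max K₁ K₂, ?_, congrFun e, fun t => ?_, fun t => ⟨?_, ?_⟩, fun t ht => ⟨?_, ?_⟩⟩
  · exact ((norm_nonneg _).trans (h₁ 0)).trans (le_max_left _ _)
  · have hd := (hη.differentiable (by simp) t).hasDerivAt
    rw [e, ((hd.fun_pow 2).fun_neg).deriv]
    simp
  · exact (h₁ t).trans (le_max_left _ _)
  · exact (h₂ t).trans (le_max_right _ _)
  · exact image_eq_zero_of_notMem_tsupport fun h' => ht (hs h')
  · exact image_eq_zero_of_notMem_tsupport fun h' => ht (hs (tsupport_deriv_subset h'))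

lemma deriv_eq_zero (hχ : IsCutoff χ) {t : ℝ} (ht : t ∉ Ioo 1 2) :
    deriv χ t = 0 ∧ deriv (deriv χ) t = 0 := by
  obtain ⟨η, K, -, h₁, h₂, -, h₃⟩ := hχ.exists_sqrt
  simp [h₁, h₂, h₃ t ht]

lemma exists_bound (hχ : IsCutoff χ) :
    ∃ K, 0 < K ∧ ∀ t, |deriv χ t| ≤ K ∧ |deriv (deriv χ) t| ≤ K := by
  obtain ⟨η, K, hK, h₁, h₂, h₃, -⟩ := hχ.exists_sqrt
  refine ⟨2 * K ^ 2 + 1, by positivity, fun t => ⟨?_, ?_⟩⟩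
  · rw [h₁, abs_neg, abs_pow]
    have := pow_le_pow_left₀ (abs_nonneg _) (h₃ t).1 2
    nlinarith
  · rw [h₂, abs_neg, abs_mul, abs_mul, abs_two]
    have := mul_le_mul (h₃ t).1 (h₃ t).2 (abs_nonneg _) hK
    nlinarith

/-- A cut-off function vanishes from some point smaller than `2` on. -/
lemma exists_eq_zero (hχ : IsCutoff χ) :
    ∃ d, d < 2 ∧ ∀ t, d ≤ t → χ t = 0 ∧ deriv χ t = 0 ∧ deriv (deriv χ) t = 0 := by
  obtain ⟨η, hη, hc, hs, h⟩ := hχ.neg_deriv_eq_sq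
  obtain ⟨δ, hδ, hK⟩ : ∃ δ > 0, ∀ t ∈ tsupport η, δ ≤ 2 - t :=
    hc.isCompact.exists_forall_le' (by fun_prop) fun t ht => sub_pos.2 (hs ht).2
  have e : deriv χ = fun t => -η t ^ 2 := by
    funext t; linarith [h t]
  have h0 : ∀ t, 2 - δ / 2 ≤ t → deriv χ t = 0 := fun t ht => by
    rw [e]
    have : η t = 0 := image_eq_zero_of_notMem_tsupport fun h' => by linarith [hK t h']
    simp [this]
  refine ⟨2 - δ / 2, by linarith, fun t ht => ⟨?_, h0 t ht, ?_⟩⟩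
  · rcases le_or_gt 2 t with h2 | h2
    · exact hχ.eq_zero t h2
    · obtain ⟨c, hc, hd⟩ := exists_deriv_eq_slope χ h2 hχ.smooth.continuous.continuousOn
        hχ.differentiable.differentiableOn
      rw [h0 c (ht.trans hc.1.le), hχ.eq_zero 2 le_rfl, eq_comm, div_eq_zero_iff] at hd
      rcases hd with hd | hd <;> linarith
  · have : t ∉ tsupport η := fun h' => by linarith [hK t h']
    have h1 : deriv χ =ᶠ[𝓝 t] fun _ => 0 := by
      filter_upwards [(notMem_tsupport_iff_eventuallyEq.1 this)] with s hs
      rw [e]; simp [hs]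
    rw [h1.deriv_eq, deriv_const]

end IsCutoff

/-- The factor `κ` with `d[χ(𝔯_q/b)] = κ(𝔯_q) (ρ² dρ² + 2φ d(2φ))`. -/
def cutoffDeriv (χ : ℝ → ℝ) (b r : ℝ) : ℝ := deriv χ (r / b) / b / (2 * r ^ 3)

/-- The factor `λ` with `d[κ(𝔯_q)] = λ(𝔯_q) (ρ² dρ² + 2φ d(2φ))`, for `κ = cutoffDeriv χ b`. -/
def cutoffDeriv₂ (χ : ℝ → ℝ) (b r : ℝ) : ℝ :=
  (deriv (deriv χ) (r / b) / b ^ 2 - 3 * deriv χ (r / b) / (b * r)) / (4 * r ^ 6)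

section

variable {χ : ℝ → ℝ} {b : ℝ}

lemma cutoffDeriv_eq_zero (hχ : IsCutoff χ) {r : ℝ} (h : r / b ∉ Ioo 1 2) :
    cutoffDeriv χ b r = 0 ∧ cutoffDeriv₂ χ b r = 0 := by
  simp [cutoffDeriv, cutoffDeriv₂, hχ.deriv_eq_zero h]

lemma eventually_gaugeAt_lt (h : gaugeAt q x < b) : ∀ᶠ y in 𝓝 x, gaugeAt q y < b :=
  (continuous_gaugeAt q).continuousAt.eventually (gt_mem_nhds h)

lemma hasRHDeriv_cutoff (hχ : IsCutoff χ) (hb : 0 < b) (q x : Heis) :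
    HasRHDeriv q (fun y => χ (gaugeAt q y / b)) (cutoffDeriv χ b (gaugeAt q x) * sqNorm q x)
      (cutoffDeriv χ b (gaugeAt q x) * height q x) x := by
  rcases (gaugeAt_nonneg q x).eq_or_lt with h | h
  -- The derivative formula for the gauge breaks down at q, but the cut-off is constant near q.
  · have h0 : gaugeAt q x / b ∉ Ioo (1 : ℝ) 2 := by rw [← h]; simp
    have h1 : (fun y => χ (gaugeAt q y / b)) =ᶠ[𝓝 x] fun _ => 1 := by
      filter_upwards [eventually_gaugeAt_lt (h ▸ hb)] with y hy
      exact hχ.eq_one _ ((div_le_one hb).2 hy.le)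
    simpa [cutoffDeriv_eq_zero hχ h0] using (HasRHDeriv.const (q := q) 1).congr_of_eventuallyEq h1
  · have hd : HasDerivAt (fun r => χ (r / b)) (deriv χ (gaugeAt q x / b) * (1 / b)) (gaugeAt q x) :=
      (hχ.differentiable _).hasDerivAt.comp _ ((hasDerivAt_id _).div_const b)
    refine (HasRHDeriv.comp hd (hasRHDeriv_gaugeAt h)).congr_deriv ?_ ?_ <;>
      (rw [cutoffDeriv]; ring)

lemma hasRHDeriv_cutoffDeriv (hχ : IsCutoff χ) (hb : 0 < b) (q x : Heis) :
    HasRHDeriv q (fun y => cutoffDeriv χ b (gaugeAt q y))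
      (cutoffDeriv₂ χ b (gaugeAt q x) * sqNorm q x)
      (cutoffDeriv₂ χ b (gaugeAt q x) * height q x) x := by
  rcases (gaugeAt_nonneg q x).eq_or_lt with h | h
  · have h0 : gaugeAt q x / b ∉ Ioo (1 : ℝ) 2 := by rw [← h]; simp
    have h1 : (fun y => cutoffDeriv χ b (gaugeAt q y)) =ᶠ[𝓝 x] fun _ => 0 := by
      filter_upwards [eventually_gaugeAt_lt (h ▸ hb)] with y hy
      exact (cutoffDeriv_eq_zero hχ fun h' => absurd h'.1 (not_lt.2 ((div_le_one hb).2 hy.le))).1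
    simpa [cutoffDeriv_eq_zero hχ h0] using (HasRHDeriv.const (q := q) 0).congr_of_eventuallyEq h1
  · have hd : HasDerivAt (fun r => deriv χ (r / b))
        (deriv (deriv χ) (gaugeAt q x / b) * (1 / b)) (gaugeAt q x) :=
      (hχ.differentiable_deriv _).hasDerivAt.comp _ ((hasDerivAt_id _).div_const b)
    have hd2 : HasDerivAt (cutoffDeriv χ b) _ (gaugeAt q x) :=
      (hd.div_const b).fun_div (((hasDerivAt_id _).fun_pow 3).const_mul 2) (by simp [h.ne'])
    refine (HasRHDeriv.comp hd2 (hasRHDeriv_gaugeAt h)).congr_deriv ?_ ?_ <;>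
      (rw [cutoffDeriv₂]; field_simp; norm_num; ring)

end

end

section

variable {q x : Heis} {χ : ℝ → ℝ} {b ε : ℝ} {P : LegendrianGrassmannian}

/-! ### The first variation along cut-offs of the regularized phase -/

/-- The squared norm of the tangential part of the horizontal position vector. -/
def tanNormSq (q : Heis) (P : LegendrianGrassmannian) : ℝ :=
  planeForm P.2 (disp q P.1) (disp q P.1)

/-- The inner product of the tangential parts of the position vector `z` and of `iz`. -/
def tanCross (q : Heis) (P : LegendrianGrassmannian) : ℝ :=
  planeForm P.2 (disp q P.1) (mulI (disp q P.1))

/-- Minus the tangential divergence of the Hamiltonian field of the regularized phase. -/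
def phaseEnergy (q : Heis) (ε : ℝ) (P : LegendrianGrassmannian) : ℝ :=
  2 * (-(4 * tanCross q P * height q P.1 * (sqNorm q P.1 + ε))
    + (sqNorm q P.1 - 2 * tanNormSq q P) * ((sqNorm q P.1 + ε) ^ 2 - height q P.1 ^ 2)
    + (sqNorm q P.1 + ε) * modSq q ε P.1) / modSq q ε P.1 ^ 2

/-- The part of the first variation along `χ(𝔯_q/b) · phase q ε` that contains derivatives of the
cut-off. -/
def boundaryTerm (χ : ℝ → ℝ) (q : Heis) (ε b : ℝ) (P : LegendrianGrassmannian) : ℝ :=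
  2 * (phase q ε P.1 * (cutoffDeriv₂ χ b (gaugeAt q P.1) *
      (tanCross q P * (sqNorm q P.1 ^ 2 - height q P.1 ^ 2)
        + (sqNorm q P.1 - 2 * tanNormSq q P) * (sqNorm q P.1 * height q P.1))
      - cutoffDeriv χ b (gaugeAt q P.1) * height q P.1)
    + cutoffDeriv χ b (gaugeAt q P.1) *
      (-(2 * tanCross q P * (2 * sqNorm q P.1 + ε) * height q P.1)
        + (sqNorm q P.1 - 2 * tanNormSq q P) *
          (sqNorm q P.1 * (sqNorm q P.1 + ε) - height q P.1 ^ 2)) / modSq q ε P.1)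

lemma tanNormSq_nonneg (q : Heis) (P : LegendrianGrassmannian) : 0 ≤ tanNormSq q P :=
  P.2.planeForm_self_nonneg _

lemma tanNormSq_le (q : Heis) (P : LegendrianGrassmannian) : tanNormSq q P ≤ sqNorm q P.1 := by
  have h := P.2.planeForm_self_nonneg (mulI (disp q P.1))
  rw [LagrangianPlane.planeForm_mulI, ← sqNorm_eq_dotProduct] at h
  exact sub_nonneg.1 h

lemma tanCross_sq_le (q : Heis) (P : LegendrianGrassmannian) :
    tanCross q P ^ 2 ≤ tanNormSq q P * (sqNorm q P.1 - tanNormSq q P) := by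
  have h := P.2.planeForm_sq_le (disp q P.1) (mulI (disp q P.1))
  rwa [LagrangianPlane.planeForm_mulI, ← sqNorm_eq_dotProduct] at h

lemma two_mul_abs_tanCross_le (q : Heis) (P : LegendrianGrassmannian) :
    2 * |tanCross q P| ≤ sqNorm q P.1 := by
  rw [← abs_two, ← abs_mul]
  refine abs_le_of_sq_le_sq ?_ (sqNorm_nonneg q _)
  nlinarith [tanCross_sq_le q P, sq_nonneg (sqNorm q P.1 - 2 * tanNormSq q P)]

lemma abs_sub_two_mul_tanNormSq_le (q : Heis) (P : LegendrianGrassmannian) :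
    |sqNorm q P.1 - 2 * tanNormSq q P| ≤ sqNorm q P.1 :=
  abs_le.2 ⟨by linarith [tanNormSq_le q P], by linarith [tanNormSq_nonneg q P]⟩

/-- With S = R + ε and m, n the squared tangential lengths of z and iz (m + n = R), the bracket in
the numerator is 2(mΦ² + nS² - 2kΦS) + ε(S² + Φ²). The quadratic form is nonnegative because k² ≤
mn. The ε-term is the excess 2ε / `modSq` over the squared tangential gradient of the regularized
phase. -/
lemma phaseEnergy_nonneg (hε : 0 ≤ ε) : 0 ≤ phaseEnergy q ε P := by
  have hm := tanNormSq_nonneg q P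
  have hn := sub_nonneg.2 (tanNormSq_le q P)
  have hk := tanCross_sq_le q P
  unfold phaseEnergy modSq
  set m := tanNormSq q P
  set k := tanCross q P
  set R := sqNorm q P.1
  set Φ := height q P.1
  set n := R - m with hn'
  have hR : R = m + n := by rw [hn']; ring
  set S := R + ε with hS
  have hS0 : 0 ≤ S := by linarith
  have hquad : 2 * k * (Φ * S) ≤ m * Φ ^ 2 + n * S ^ 2 := by
    refine le_of_abs_le (abs_le_of_sq_le_sq ?_ (by positivity))
    have h1 : k ^ 2 * (Φ * S) ^ 2 ≤ m * n * (Φ * S) ^ 2 :=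
      mul_le_mul_of_nonneg_right hk (sq_nonneg _)
    nlinarith [sq_nonneg (m * Φ ^ 2 - n * S ^ 2)]
  have hnum : 0 ≤ -(4 * k * Φ * S) + (R - 2 * m) * (S ^ 2 - Φ ^ 2) + S * (S ^ 2 + Φ ^ 2) := by
    have h1 : 0 ≤ ε * (S ^ 2 + Φ ^ 2) := by positivity
    have h2 : S = m + n + ε := by rw [hS, hR]
    have h3 : S * (S ^ 2 + Φ ^ 2) = (m + n) * (S ^ 2 + Φ ^ 2) + ε * (S ^ 2 + Φ ^ 2) := by
      rw [← add_mul, ← h2]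
    rw [h3, hR]
    nlinarith
  positivity

lemma phaseEnergy_le_div (hε : 0 ≤ ε) (hN : 0 < modSq q ε P.1) :
    phaseEnergy q ε P ≤ 6 * (sqNorm q P.1 + ε) / modSq q ε P.1 := by
  have hk := two_mul_abs_tanCross_le q P
  have hm := abs_sub_two_mul_tanNormSq_le q P
  have hR := sqNorm_nonneg q P.1
  have hdef : modSq q ε P.1 = (sqNorm q P.1 + ε) ^ 2 + height q P.1 ^ 2 := rfl
  unfold phaseEnergy
  set m := tanNormSq q P
  set k := tanCross q P
  set R := sqNorm q P.1
  set Φ := height q P.1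
  set N := modSq q ε P.1
  set S := R + ε with hS
  have hS0 : 0 ≤ S := by linarith
  have h1 : -(4 * k * Φ * S) ≤ S * N := by
    have e : 2 * (|Φ| * S) ≤ N := by rw [hdef]; nlinarith [sq_nonneg (|Φ| - S), sq_abs Φ]
    calc -(4 * k * Φ * S) ≤ |4 * k * Φ * S| := neg_le_abs _
      _ = 2 * |k| * (2 * (|Φ| * S)) := by
        rw [abs_mul, abs_mul, abs_mul, abs_of_nonneg hS0]; norm_num; ring
      _ ≤ R * N := mul_le_mul hk e (by positivity) hR
      _ ≤ S * N := mul_le_mul_of_nonneg_right (by linarith) hN.le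
  have h2 : (R - 2 * m) * (S ^ 2 - Φ ^ 2) ≤ S * N := by
    have e : |S ^ 2 - Φ ^ 2| ≤ N := by
      rw [hdef]; exact abs_le.2 ⟨by nlinarith [sq_nonneg S], by nlinarith [sq_nonneg Φ]⟩
    calc _ ≤ |(R - 2 * m) * (S ^ 2 - Φ ^ 2)| := le_abs_self _
      _ = |R - 2 * m| * |S ^ 2 - Φ ^ 2| := abs_mul _ _
      _ ≤ R * N := mul_le_mul hm e (abs_nonneg _) hR
      _ ≤ S * N := mul_le_mul_of_nonneg_right (by linarith) hN.le
  rw [div_le_div_iff₀ (by positivity) hN]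
  have h3 : (-(4 * k * Φ * S) + (R - 2 * m) * (S ^ 2 - Φ ^ 2) + S * N) * N ≤ 3 * (S * N) * N :=
    mul_le_mul_of_nonneg_right (by linarith) hN.le
  nlinarith

/-- Uniform in ε, hence a majorant away from q. It reduces to S𝔯² ≤ N for N = `modSq`, which follows
from 2S𝔯² ≤ S² + 𝔯⁴ and N ≥ S², N ≥ 𝔯⁴. -/
lemma phaseEnergy_le (hε : 0 ≤ ε) (h : 0 < gaugeAt q P.1) :
    phaseEnergy q ε P ≤ 6 / gaugeAt q P.1 ^ 2 := by
  have hR := sqNorm_nonneg q P.1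
  have hN := modSq_pos hε (Or.inl h)
  have h4 := gaugeAt_pow_four q P.1
  refine (phaseEnergy_le_div hε hN).trans ?_
  rw [div_le_div_iff₀ hN (by positivity)]
  rw [modSq] at hN ⊢
  have : gaugeAt q P.1 ^ 4 ≤ (sqNorm q P.1 + ε) ^ 2 + height q P.1 ^ 2 := by rw [h4]; nlinarith
  nlinarith [sq_nonneg (sqNorm q P.1 + ε - gaugeAt q P.1 ^ 2), sq_nonneg (height q P.1)]

/-- Valid at q as well, so it gives integrability of the cut-off energy for each fixed ε. -/
lemma phaseEnergy_le_div_self (hε : 0 < ε) : phaseEnergy q ε P ≤ 6 / ε := by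
  have hR := sqNorm_nonneg q P.1
  have hN := modSq_pos (x := P.1) (q := q) hε.le (Or.inr hε)
  refine (phaseEnergy_le_div hε.le hN).trans ?_
  rw [div_le_div_iff₀ hN hε, modSq]
  nlinarith [sq_nonneg (height q P.1), mul_nonneg hR hR, mul_nonneg hR hε.le]

lemma phaseEnergy_zero (h : 0 < gaugeAt q P.1) :
    phaseEnergy q 0 P = tGrad (arctanPhaseAt q) P ⬝ᵥ tGrad (arctanPhaseAt q) P := by
  have hN := modSq_pos le_rfl (Or.inl h)
  have hd := hasRHDeriv_phase le_rfl (Or.inl h)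
  rw [arctanPhaseAt_eq_phase, hd.tGrad_dotProduct_tGrad hd]
  change _ = 4 * (_ * tanNormSq q P + _ * tanCross q P + _ * (_ - tanNormSq q P))
  unfold phaseEnergy
  have hdef : modSq q 0 P.1 = sqNorm q P.1 ^ 2 + height q P.1 ^ 2 := by simp [modSq]
  field_simp
  rw [hdef]
  ring

/-- The test function `χ(𝔯_q/b) · phase q ε`. -/
def testFunction (χ : ℝ → ℝ) (q : Heis) (ε b : ℝ) (x : Heis) : ℝ :=
  χ (gaugeAt q x / b) * phase q ε x

lemma contDiff_testFunction (hχ : IsCutoff χ) (hb : 0 < b) (hε : 0 < ε) :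
    ContDiff ℝ ∞ (testFunction χ q ε b) := by
  refine contDiff_iff_contDiffAt.2 fun x => ContDiffAt.mul ?_ (contDiffAt_phase hε.le (Or.inr hε))
  rcases (gaugeAt_nonneg q x).eq_or_lt with h | h
  · refine (contDiffAt_const (c := (1 : ℝ))).congr_of_eventuallyEq ?_
    filter_upwards [eventually_gaugeAt_lt (h ▸ hb)] with y hy
    exact hχ.eq_one _ ((div_le_one hb).2 hy.le)
  · exact hχ.smooth.contDiffAt.comp x ((contDiffAt_gaugeAt h).div_const b)

/-- Product rule in the two variables R and Φ: terms in which the cut-off is not differentiated form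
the energy, all others the boundary term. -/
theorem tDiv_testFunction (hχ : IsCutoff χ) (hb : 0 < b) (hε : 0 < ε)
    (P : LegendrianGrassmannian) :
    tDiv (hamField (testFunction χ q ε b)) P =
      boundaryTerm χ q ε b P - χ (gaugeAt q P.1 / b) * phaseEnergy q ε P := by
  have hψ := fun y => hasRHDeriv_cutoff hχ hb q y
  have hκ := hasRHDeriv_cutoffDeriv hχ hb q P.1
  have hU := fun y => hasRHDeriv_phase (q := q) (x := y) hε.le (Or.inr hε)
  have hR := hasRHDeriv_sqNorm q P.1
  have hΦ := hasRHDeriv_height q P.1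
  have hN := modSq_pos (q := q) (x := P.1) hε.le (Or.inr hε)
  have ha := ((hκ.mul hR).mul (hU P.1)).add
    ((hψ P.1).mul (hasRHDeriv_phase_deriv_fst hε.le (Or.inr hε)))
  have hb' := ((hκ.mul hΦ).mul (hU P.1)).add
    ((hψ P.1).mul (hasRHDeriv_phase_deriv_snd hε.le (Or.inr hε)))
  rw [tDiv_hamField_of_hasRHDeriv (contDiff_testFunction hχ hb hε)
    (fun y => (hψ y).mul (hU y)) ha hb']
  change 2 * (tanCross q P * _ + (_ - tanNormSq q P) * _ - tanNormSq q P * _ - _) = _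
  unfold boundaryTerm phaseEnergy
  field_simp
  ring

end

section

variable {q x : Heis} {χ : ℝ → ℝ} {b ε : ℝ} {P : LegendrianGrassmannian}

/-! ### The boundary term -/

lemma boundaryTerm_eq_zero (hχ : IsCutoff χ) (h : gaugeAt q P.1 / b ∉ Ioo 1 2) :
    boundaryTerm χ q ε b P = 0 := by
  simp [boundaryTerm, cutoffDeriv_eq_zero hχ h]

lemma abs_phase_le (hε : 0 ≤ ε) (q x : Heis) : |phase q ε x| ≤ 2 := by
  have h : |phase q ε x| ≤ Real.pi / 2 :=
    Complex.abs_arg_le_pi_div_two_iff.2 (add_nonneg (sqNorm_nonneg q x) hε)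
  linarith [Real.pi_le_four]

lemma abs_cutoffDeriv_le {K r : ℝ} (hK : ∀ t, |deriv χ t| ≤ K ∧ |deriv (deriv χ) t| ≤ K)
    (hb : 0 < b) (hr : b < r) : |cutoffDeriv χ b r| ≤ K / (2 * b ^ 2 * r ^ 2) := by
  have hr0 : 0 < r := hb.trans hr
  have hK0 : 0 ≤ K := (abs_nonneg _).trans (hK 0).1
  calc |cutoffDeriv χ b r| = |deriv χ (r / b)| / (2 * b * (r * r ^ 2)) := by
        rw [cutoffDeriv, abs_div, abs_div, abs_of_pos hb, abs_of_pos (by positivity : 0 < 2 * r ^ 3)]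
        field_simp
    _ ≤ K / (2 * b * (b * r ^ 2)) := by
        have := (hK (r / b)).1
        gcongr
    _ = _ := by ring

lemma abs_cutoffDeriv₂_le {K r : ℝ} (hK : ∀ t, |deriv χ t| ≤ K ∧ |deriv (deriv χ) t| ≤ K)
    (hb : 0 < b) (hr : b < r) : |cutoffDeriv₂ χ b r| ≤ K / (b ^ 2 * r ^ 6) := by
  have hr0 : 0 < r := hb.trans hr
  have hK0 : 0 ≤ K := (abs_nonneg _).trans (hK 0).1
  have h1 : |deriv (deriv χ) (r / b) / b ^ 2| ≤ K / b ^ 2 := by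
    rw [abs_div, abs_of_pos (by positivity : 0 < b ^ 2)]
    have := (hK (r / b)).2
    gcongr
  have h2 : |3 * deriv χ (r / b) / (b * r)| ≤ 3 * K / b ^ 2 := by
    rw [abs_div, abs_mul, abs_of_pos (by positivity : 0 < b * r), abs_of_pos (by norm_num : (0:ℝ) < 3), sq]
    have := (hK (r / b)).1
    gcongr
  rw [cutoffDeriv₂, abs_div, abs_of_pos (by positivity : 0 < 4 * r ^ 6)]
  calc _ ≤ (K / b ^ 2 + 3 * K / b ^ 2) / (4 * r ^ 6) := by
        have := (abs_sub _ _).trans (add_le_add h1 h2)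
        gcongr
    _ = _ := by field_simp; norm_num

/-- Homogeneity: R, Φ and the tangential quantities are O(𝔯²), while the first and second cut-off
factors are O(b⁻²𝔯⁻²) and O(b⁻²𝔯⁻⁶) on b < 𝔯 < 2b. The constant is 11 = 2(2·2 + 3/2), with |phase| ≤
π/2 ≤ 2. Uniformity in ε is what allows the limit ε → 0. -/
lemma abs_boundaryTerm_le {K : ℝ} (hχ : IsCutoff χ)
    (hK : ∀ t, |deriv χ t| ≤ K ∧ |deriv (deriv χ) t| ≤ K) (hb : 0 < b) (hε : 0 ≤ ε)
    (q : Heis) (P : LegendrianGrassmannian) :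
    |boundaryTerm χ q ε b P| ≤ 11 * K / b ^ 2 := by
  have hK0 : 0 ≤ K := (abs_nonneg _).trans (hK 0).1
  by_cases hmem : gaugeAt q P.1 / b ∈ Ioo 1 2
  swap
  · rw [boundaryTerm_eq_zero hχ hmem, abs_zero]; positivity
  have hbr : b < gaugeAt q P.1 := (one_lt_div hb).1 hmem.1
  have hr : 0 < gaugeAt q P.1 := hb.trans hbr
  have h1 := abs_cutoffDeriv_le hK hb hbr
  have h2 := abs_cutoffDeriv₂_le hK hb hbr
  have hu := abs_phase_le hε q P.1
  have hk := two_mul_abs_tanCross_le q P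
  have hm := abs_sub_two_mul_tanNormSq_le q P
  have hR := sqNorm_nonneg q P.1
  have hRr := sqNorm_le_gaugeAt_sq q P.1
  have hΦr := abs_height_le_gaugeAt_sq q P.1
  have hN := modSq_pos hε (Or.inl hr)
  have hdef : modSq q ε P.1 = (sqNorm q P.1 + ε) ^ 2 + height q P.1 ^ 2 := rfl
  unfold boundaryTerm
  set κ := cutoffDeriv χ b (gaugeAt q P.1)
  set l := cutoffDeriv₂ χ b (gaugeAt q P.1)
  set u := phase q ε P.1
  set m := tanNormSq q P
  set k := tanCross q P
  set R := sqNorm q P.1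
  set Φ := height q P.1
  set r := gaugeAt q P.1
  set N := modSq q ε P.1
  have hRabs : |R| = R := abs_of_nonneg hR
  have hm' : |R - 2 * m| ≤ r ^ 2 := hm.trans hRr
  have hk' : |k| ≤ r ^ 2 / 2 := by linarith
  have e1 : |k * (R ^ 2 - Φ ^ 2) + (R - 2 * m) * (R * Φ)| ≤ 3 / 2 * r ^ 6 := by
    have a1 : |R ^ 2 - Φ ^ 2| ≤ r ^ 4 := by
      have : R ^ 2 + Φ ^ 2 = r ^ 4 := (gaugeAt_pow_four q P.1).symm
      exact abs_le.2 ⟨by nlinarith [sq_nonneg R], by nlinarith [sq_nonneg Φ]⟩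
    have a2 : |R * Φ| ≤ r ^ 2 * r ^ 2 := by
      rw [abs_mul, hRabs]; gcongr
    calc _ ≤ |k * (R ^ 2 - Φ ^ 2)| + |(R - 2 * m) * (R * Φ)| := abs_add_le _ _
      _ ≤ r ^ 2 / 2 * r ^ 4 + r ^ 2 * (r ^ 2 * r ^ 2) := by
        rw [abs_mul, abs_mul (R - 2 * m)]; gcongr
      _ = _ := by ring
  have e2 : |l * (k * (R ^ 2 - Φ ^ 2) + (R - 2 * m) * (R * Φ)) - κ * Φ| ≤ 2 * K / b ^ 2 := by
    calc _ ≤ |l * (k * (R ^ 2 - Φ ^ 2) + (R - 2 * m) * (R * Φ))| + |κ * Φ| := abs_sub _ _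
      _ ≤ K / (b ^ 2 * r ^ 6) * (3 / 2 * r ^ 6) + K / (2 * b ^ 2 * r ^ 2) * r ^ 2 := by
        rw [abs_mul, abs_mul κ]; gcongr
      _ = _ := by field_simp; norm_num
  have e3 : |-(2 * k * (2 * R + ε) * Φ) + (R - 2 * m) * (R * (R + ε) - Φ ^ 2)| ≤ 3 * r ^ 2 * N := by
    have a1 : |(2 * R + ε) * Φ| ≤ 2 * N := by
      rw [abs_mul, abs_of_nonneg (by linarith : 0 ≤ 2 * R + ε), hdef, ← sq_abs Φ]
      nlinarith [sq_nonneg (R + ε - |Φ|), abs_nonneg Φ]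
    have a2 : |R * (R + ε) - Φ ^ 2| ≤ N := by
      rw [hdef]
      have : 0 ≤ R * ε := by positivity
      exact abs_le.2 ⟨by nlinarith [sq_nonneg (R + ε)], by nlinarith [sq_nonneg Φ]⟩
    calc _ ≤ |-(2 * k * (2 * R + ε) * Φ)| + |(R - 2 * m) * (R * (R + ε) - Φ ^ 2)| := abs_add_le _ _
      _ = 2 * |k| * |(2 * R + ε) * Φ| + |R - 2 * m| * |R * (R + ε) - Φ ^ 2| := by
        rw [abs_neg, mul_assoc (2 * k), abs_mul (2 * k), abs_mul 2 k, abs_two, abs_mul (R - 2 * m)]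
      _ ≤ 2 * (r ^ 2 / 2) * (2 * N) + r ^ 2 * N := by gcongr
      _ = _ := by ring
  have e4 : |κ * (-(2 * k * (2 * R + ε) * Φ) + (R - 2 * m) * (R * (R + ε) - Φ ^ 2)) / N|
      ≤ 3 / 2 * K / b ^ 2 := by
    rw [abs_div, abs_of_pos hN, abs_mul]
    calc _ ≤ K / (2 * b ^ 2 * r ^ 2) * (3 * r ^ 2 * N) / N := by gcongr
      _ = _ := by field_simp
  rw [abs_mul, abs_two]
  calc _ ≤ 2 * (|u * (l * (k * (R ^ 2 - Φ ^ 2) + (R - 2 * m) * (R * Φ)) - κ * Φ)|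
        + |κ * (-(2 * k * (2 * R + ε) * Φ) + (R - 2 * m) * (R * (R + ε) - Φ ^ 2)) / N|) := by
        gcongr; exact abs_add_le _ _
    _ ≤ 2 * (2 * (2 * K / b ^ 2) + 3 / 2 * K / b ^ 2) := by
        rw [abs_mul]; gcongr
    _ = _ := by ring

/-! ### The integrands of `Θ^χ` -/

lemma integrandGauge_eq (hb : 0 < b) (hr : 0 < gaugeAt q P.1) :
    integrandGauge χ q b P = 2 * cutoffDeriv χ b (gaugeAt q P.1) *
      (sqNorm q P.1 ^ 2 * tanNormSq q P + 2 * sqNorm q P.1 * height q P.1 * tanCross q P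
        + height q P.1 ^ 2 * (sqNorm q P.1 - tanNormSq q P)) / gaugeAt q P.1 ^ 4 := by
  have hd := hasRHDeriv_gaugeAt hr
  rw [integrandGauge, hd.tGrad_dotProduct_tGrad hd]
  change 4 * (_ * tanNormSq q P + _ * tanCross q P + _ * (_ - tanNormSq q P)) / _ * _ = _
  rw [cutoffDeriv]
  field_simp
  ring

lemma integrandPhase_eq (hb : 0 < b) (hr : 0 < gaugeAt q P.1) :
    integrandPhase χ q b P =
      2 * cutoffDeriv χ b (gaugeAt q P.1) * height q P.1 * phase q 0 P.1 := by
  rw [integrandPhase, arctanPhaseAt_eq_phase, cutoffDeriv, height]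
  field_simp

/-- This pointwise identity is the reason for the three-term form of Θ^χ: combined as in its
definition, the integrands add up to the boundary term at ε = 0. -/
lemma integrandCross_eq (hχ : IsCutoff χ) (hb : 0 < b) (hr : 0 < gaugeAt q P.1) :
    integrandCross χ q b P = 4 * (boundaryTerm χ q 0 b P + integrandGauge χ q b P
      + integrandPhase χ q b P) := by
  have hu := hasRHDeriv_phase le_rfl (Or.inl hr)
  have hN := modSq_pos le_rfl (Or.inl hr)
  have hf : (fun x => (gaugeAt q x ^ 3)⁻¹ * (b⁻¹ * deriv χ (gaugeAt q x / b)) * arctanPhaseAt q x)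
      = fun x => 2 * cutoffDeriv χ b (gaugeAt q x) * phase q 0 x := by
    funext y
    rw [arctanPhaseAt_eq_phase, cutoffDeriv]
    rcases (gaugeAt_nonneg q y).eq_or_lt with h | h
    · rw [← h]; simp
    · field_simp
  have hprod := (((HasRHDeriv.const 2).mul (hasRHDeriv_cutoffDeriv hχ hb q P.1)).mul hu)
  have hdef : modSq q 0 P.1 = sqNorm q P.1 ^ 2 + height q P.1 ^ 2 := by simp [modSq]
  rw [integrandCross, hf, integrandGauge_eq hb hr, integrandPhase_eq hb hr, gaugeAt_pow_four,
    arctanPhaseAt_eq_phase, hu.tGrad_dotProduct_tGrad hprod, ← hdef]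
  change _ * (4 * (_ * tanNormSq q P + _ * tanCross q P + _ * (_ - tanNormSq q P))) = _
  rw [boundaryTerm]
  field_simp
  rw [hdef]
  ring

lemma integrands_eq_zero (hχ : IsCutoff χ) (h : gaugeAt q P.1 / b ∉ Ioo 1 2) :
    integrandGauge χ q b P = 0 ∧ integrandPhase χ q b P = 0 := by
  simp [integrandGauge, integrandPhase, hχ.deriv_eq_zero h]

end

section

variable {q x : Heis} {χ : ℝ → ℝ} {b ε : ℝ} {P : LegendrianGrassmannian}

lemma integrandCross_eq' (hχ : IsCutoff χ) (hb : 0 < b) (P : LegendrianGrassmannian) :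
    integrandCross χ q b P = 4 * (boundaryTerm χ q 0 b P + integrandGauge χ q b P
      + integrandPhase χ q b P) := by
  rcases (gaugeAt_nonneg q P.1).eq_or_lt with h | h
  · have h0 : gaugeAt q P.1 / b ∉ Ioo (1 : ℝ) 2 := by rw [← h]; simp
    simp [boundaryTerm_eq_zero hχ h0, integrands_eq_zero hχ h0, integrandCross, ← h]
  · exact integrandCross_eq hχ hb h

/-! ### Measurability -/

section Measurability

@[fun_prop] lemma measurable_gaugeAt (q : Heis) :
    Measurable fun P : LegendrianGrassmannian => gaugeAt q P.1 :=
  (continuous_gaugeAt q).measurable.comp measurable_fst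

@[fun_prop] lemma measurable_sqNorm (q : Heis) :
    Measurable fun P : LegendrianGrassmannian => sqNorm q P.1 :=
  (continuous_sqNorm q).measurable.comp measurable_fst

@[fun_prop] lemma measurable_height (q : Heis) :
    Measurable fun P : LegendrianGrassmannian => height q P.1 :=
  (continuous_height q).measurable.comp measurable_fst

@[fun_prop] lemma measurable_modSq (q : Heis) (ε : ℝ) :
    Measurable fun P : LegendrianGrassmannian => modSq q ε P.1 := by
  unfold modSq; fun_prop

@[fun_prop] lemma measurable_phase (q : Heis) (ε : ℝ) :
    Measurable fun P : LegendrianGrassmannian => phase q ε P.1 := by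
  unfold phase
  refine Complex.measurable_arg.comp ?_
  have h : Measurable fun P : LegendrianGrassmannian =>
      Complex.equivRealProdCLM.symm (sqNorm q P.1 + ε, height q P.1) :=
    Complex.equivRealProdCLM.symm.continuous.measurable.comp (by fun_prop)
  exact h

lemma continuous_disp (q : Heis) : Continuous fun P : LegendrianGrassmannian => disp q P.1 := by
  unfold disp; fun_prop

@[fun_prop] lemma measurable_tanNormSq (q : Heis) : Measurable (tanNormSq q) :=
  (LagrangianPlane.continuous_planeForm continuous_snd (continuous_disp q)
    (continuous_disp q)).measurable

@[fun_prop] lemma measurable_tanCross (q : Heis) : Measurable (tanCross q) := by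
  refine (LagrangianPlane.continuous_planeForm continuous_snd (continuous_disp q) ?_).measurable
  simp only [mulI_eq_mulVec]
  exact continuous_const.matrix_mulVec (continuous_disp q)

@[fun_prop] lemma measurable_cutoffDeriv (χ : ℝ → ℝ) (b : ℝ) : Measurable (cutoffDeriv χ b) := by
  have := measurable_deriv χ
  unfold cutoffDeriv; fun_prop

@[fun_prop] lemma measurable_cutoffDeriv₂ (χ : ℝ → ℝ) (b : ℝ) : Measurable (cutoffDeriv₂ χ b) := by
  have := measurable_deriv χ
  have := measurable_deriv (deriv χ)
  unfold cutoffDeriv₂; fun_prop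

@[fun_prop] lemma measurable_phaseEnergy (q : Heis) (ε : ℝ) : Measurable (phaseEnergy q ε) := by
  unfold phaseEnergy; fun_prop

@[fun_prop] lemma measurable_boundaryTerm (χ : ℝ → ℝ) (q : Heis) (ε b : ℝ) :
    Measurable (boundaryTerm χ q ε b) := by
  unfold boundaryTerm; fun_prop

lemma integrandGauge_eq' (hχ : IsCutoff χ) (hb : 0 < b) (q : Heis) :
    integrandGauge χ q b = fun P => 2 * cutoffDeriv χ b (gaugeAt q P.1) *
      (sqNorm q P.1 ^ 2 * tanNormSq q P + 2 * sqNorm q P.1 * height q P.1 * tanCross q P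
        + height q P.1 ^ 2 * (sqNorm q P.1 - tanNormSq q P)) / gaugeAt q P.1 ^ 4 := by
  funext P
  rcases (gaugeAt_nonneg q P.1).eq_or_lt with h | h
  · have h0 : gaugeAt q P.1 / b ∉ Ioo (1 : ℝ) 2 := by rw [← h]; simp
    simp [integrands_eq_zero hχ h0, cutoffDeriv_eq_zero hχ h0]
  · exact integrandGauge_eq hb h

lemma integrandPhase_eq' (hχ : IsCutoff χ) (hb : 0 < b) (q : Heis) :
    integrandPhase χ q b =
      fun P => 2 * cutoffDeriv χ b (gaugeAt q P.1) * height q P.1 * phase q 0 P.1 := by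
  funext P
  rcases (gaugeAt_nonneg q P.1).eq_or_lt with h | h
  · have h0 : gaugeAt q P.1 / b ∉ Ioo (1 : ℝ) 2 := by rw [← h]; simp
    simp [integrands_eq_zero hχ h0, cutoffDeriv_eq_zero hχ h0]
  · exact integrandPhase_eq hb h

lemma measurable_integrandGauge (hχ : IsCutoff χ) (hb : 0 < b) (q : Heis) :
    Measurable (integrandGauge χ q b) := by
  rw [integrandGauge_eq' hχ hb]; fun_prop

lemma measurable_integrandPhase (hχ : IsCutoff χ) (hb : 0 < b) (q : Heis) :
    Measurable (integrandPhase χ q b) := by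
  rw [integrandPhase_eq' hχ hb]; fun_prop

end Measurability

lemma abs_integrandGauge_le {K : ℝ} (hχ : IsCutoff χ)
    (hK : ∀ t, |deriv χ t| ≤ K ∧ |deriv (deriv χ) t| ≤ K) (hb : 0 < b) (q : Heis)
    (P : LegendrianGrassmannian) : |integrandGauge χ q b P| ≤ 3 * K / b ^ 2 := by
  have hK0 : 0 ≤ K := (abs_nonneg _).trans (hK 0).1
  by_cases hmem : gaugeAt q P.1 / b ∈ Ioo 1 2
  swap
  · rw [(integrands_eq_zero hχ hmem).1, abs_zero]; positivity
  have hbr : b < gaugeAt q P.1 := (one_lt_div hb).1 hmem.1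
  have hr : 0 < gaugeAt q P.1 := hb.trans hbr
  have h1 := abs_cutoffDeriv_le hK hb hbr
  have hk := two_mul_abs_tanCross_le q P
  have hm0 := tanNormSq_nonneg q P
  have hm := tanNormSq_le q P
  have hR := sqNorm_nonneg q P.1
  have hRr := sqNorm_le_gaugeAt_sq q P.1
  have hΦr := abs_height_le_gaugeAt_sq q P.1
  have hN := gaugeAt_pow_four q P.1
  rw [integrandGauge_eq hb hr, abs_div, abs_mul, abs_mul, abs_two,
    abs_of_pos (by positivity : 0 < gaugeAt q P.1 ^ 4)]
  set κ := cutoffDeriv χ b (gaugeAt q P.1)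
  set m := tanNormSq q P
  set k := tanCross q P
  set R := sqNorm q P.1
  set Φ := height q P.1
  set r := gaugeAt q P.1
  have e : |R ^ 2 * m + 2 * R * Φ * k + Φ ^ 2 * (R - m)| ≤ 3 * r ^ 6 := by
    have a1 : |2 * R * Φ * k| ≤ r ^ 2 * r ^ 2 * r ^ 2 := by
      rw [show 2 * R * Φ * k = R * Φ * (2 * k) by ring, abs_mul, abs_mul, abs_of_nonneg hR,
        abs_mul, abs_two]
      have : 2 * |k| ≤ r ^ 2 := hk.trans hRr
      gcongr
    have a2 : R ^ 2 * m ≤ r ^ 4 * r ^ 2 := by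
      have : R ^ 2 ≤ r ^ 4 := by nlinarith [sq_nonneg Φ]
      have : m ≤ r ^ 2 := hm.trans hRr
      gcongr
    have a3 : Φ ^ 2 * (R - m) ≤ r ^ 4 * r ^ 2 := by
      have : Φ ^ 2 ≤ r ^ 4 := by nlinarith [sq_nonneg R]
      have : R - m ≤ r ^ 2 := by linarith
      have : 0 ≤ R - m := by linarith
      gcongr
    have a4 : 0 ≤ R ^ 2 * m := by positivity
    have a5 : 0 ≤ Φ ^ 2 * (R - m) := mul_nonneg (sq_nonneg _) (by linarith)
    have := abs_le.1 a1
    have r6 : 0 ≤ r ^ 6 := by positivity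
    exact abs_le.2 ⟨by nlinarith, by nlinarith⟩
  calc _ ≤ 2 * (K / (2 * b ^ 2 * r ^ 2)) * (3 * r ^ 6) / r ^ 4 := by gcongr
    _ = _ := by field_simp

lemma abs_integrandPhase_le {K : ℝ} (hχ : IsCutoff χ)
    (hK : ∀ t, |deriv χ t| ≤ K ∧ |deriv (deriv χ) t| ≤ K) (hb : 0 < b) (q : Heis)
    (P : LegendrianGrassmannian) : |integrandPhase χ q b P| ≤ 2 * K / b ^ 2 := by
  have hK0 : 0 ≤ K := (abs_nonneg _).trans (hK 0).1
  by_cases hmem : gaugeAt q P.1 / b ∈ Ioo 1 2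
  swap
  · rw [(integrands_eq_zero hχ hmem).2, abs_zero]; positivity
  have hbr : b < gaugeAt q P.1 := (one_lt_div hb).1 hmem.1
  have hr : 0 < gaugeAt q P.1 := hb.trans hbr
  have h1 := abs_cutoffDeriv_le hK hb hbr
  have hΦr := abs_height_le_gaugeAt_sq q P.1
  have hu := abs_phase_le le_rfl q P.1
  rw [integrandPhase_eq hb hr, abs_mul, abs_mul, abs_mul, abs_two]
  calc _ ≤ 2 * (K / (2 * b ^ 2 * gaugeAt q P.1 ^ 2)) * gaugeAt q P.1 ^ 2 * 2 := by gcongr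
    _ = _ := by field_simp

/-! ### Balls inside the domain of the varifold -/

variable {U : Set Heis} {v : Measure LegendrianGrassmannian}

lemma gaugeAt_lt_subset (hbU : ENNReal.ofReal b ≤ distCompl q U / 2) (h : gaugeAt q x < 2 * b) :
    x ∈ U := by
  by_contra hx
  have h1 : distCompl q U ≤ ENNReal.ofReal (gaugeAt q x) := iInf₂_le x hx
  have h2 : ENNReal.ofReal (2 * b) ≤ distCompl q U := by
    rw [ENNReal.ofReal_mul zero_le_two, mul_comm]
    simpa using (ENNReal.le_div_iff_mul_le (Or.inl two_ne_zero) (Or.inl ENNReal.ofNat_ne_top)).1 hbU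
  have h3 := (ENNReal.ofReal_le_ofReal_iff (gaugeAt_nonneg q x)).1 (h2.trans h1)
  linarith

lemma measure_gaugeAt_le_lt_top (hv : IsHSLV U v) (hbU : ENNReal.ofReal b ≤ distCompl q U / 2)
    {s : ℝ} (hs : s < 2 * b) : v {P | gaugeAt q P.1 ≤ s} < ⊤ := by
  have e : {P : LegendrianGrassmannian | gaugeAt q P.1 ≤ s} = {x | gaugeAt q x ≤ s} ×ˢ univ := by
    ext P; simp
  rw [e]
  refine hv.finite_on_compacts _ ((isCompact_gaugeAt_le q s).prod isCompact_univ) ?_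
  rintro P ⟨hP, -⟩
  exact gaugeAt_lt_subset hbU (lt_of_le_of_lt hP hs)

lemma measurableSet_gaugeAt_le (q : Heis) (s : ℝ) :
    MeasurableSet {P : LegendrianGrassmannian | gaugeAt q P.1 ≤ s} :=
  measurableSet_le (measurable_gaugeAt q) measurable_const

lemma integrable_of_bounded {f : LegendrianGrassmannian → ℝ} {s C : ℝ} (hf : Measurable f)
    (hfin : v {P | gaugeAt q P.1 ≤ s} < ⊤) (hC : ∀ P, |f P| ≤ C)
    (h0 : ∀ P, s < gaugeAt q P.1 → f P = 0) : Integrable f v := by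
  rw [← integrableOn_iff_integrable_of_support_subset
    (s := {P : LegendrianGrassmannian | gaugeAt q P.1 ≤ s})]
  · exact Measure.integrableOn_of_bounded hfin.ne hf.aestronglyMeasurable
      (Eventually.of_forall hC)
  · intro P hP
    by_contra h
    exact hP (h0 P (not_le.1 h))

/-! ### Limits as the regularization is removed -/

lemma tendsto_phase (hr : 0 < gaugeAt q x) :
    Tendsto (fun ε => phase q ε x) (𝓝 0) (𝓝 (phase q 0 x)) := by
  have h1 := Complex.continuousAt_arg (mem_slitPlane le_rfl (Or.inl hr))
  have h2 : ContinuousAt (fun ε : ℝ => Complex.equivRealProdCLM.symm (sqNorm q x + ε, height q x)) 0 :=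
    Complex.equivRealProdCLM.symm.continuous.continuousAt.comp (by fun_prop)
  exact ContinuousAt.comp (f := fun ε : ℝ =>
    Complex.equivRealProdCLM.symm (sqNorm q x + ε, height q x)) h1 h2

lemma tendsto_modSq (q x : Heis) :
    Tendsto (fun ε => modSq q ε x) (𝓝 0) (𝓝 (modSq q 0 x)) := by
  have : Continuous fun ε => modSq q ε x := by unfold modSq; fun_prop
  exact this.tendsto 0

lemma tendsto_phaseEnergy (hr : 0 < gaugeAt q P.1) :
    Tendsto (fun ε => phaseEnergy q ε P) (𝓝 0) (𝓝 (phaseEnergy q 0 P)) := by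
  have hN := modSq_pos le_rfl (Or.inl hr)
  have h : ContinuousAt (fun ε => modSq q ε P.1) 0 := tendsto_modSq q P.1
  have : ContinuousAt (fun ε => phaseEnergy q ε P) 0 := by
    unfold phaseEnergy
    exact ContinuousAt.div (by fun_prop) (by fun_prop) (by positivity)
  exact this

lemma tendsto_boundaryTerm (hχ : IsCutoff χ) (P : LegendrianGrassmannian) :
    Tendsto (fun ε => boundaryTerm χ q ε b P) (𝓝 0) (𝓝 (boundaryTerm χ q 0 b P)) := by
  rcases (gaugeAt_nonneg q P.1).eq_or_lt with hr | hr
  · have h0 : gaugeAt q P.1 / b ∉ Ioo (1 : ℝ) 2 := by rw [← hr]; simp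
    simp only [boundaryTerm_eq_zero hχ h0]
    exact tendsto_const_nhds
  · have hN := modSq_pos le_rfl (Or.inl hr)
    have h : ContinuousAt (fun ε => modSq q ε P.1) 0 := tendsto_modSq q P.1
    have h' : ContinuousAt (fun ε => phase q ε P.1) 0 := tendsto_phase hr
    have : ContinuousAt (fun ε => boundaryTerm χ q ε b P) 0 := by
      unfold boundaryTerm
      refine ContinuousAt.mul (by fun_prop) (ContinuousAt.add (by fun_prop) ?_)
      exact ContinuousAt.div (by fun_prop) (by fun_prop) hN.ne'
    exact this

end

section

variable {q x : Heis} {χ : ℝ → ℝ} {a b ε : ℝ} {P : LegendrianGrassmannian}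
  {U : Set Heis} {v : Measure LegendrianGrassmannian}

/-! ### Integrability -/

lemma integrable_of_bounded_of_eq_zero (hχ : IsCutoff χ) (hv : IsHSLV U v) (hb : 0 < b)
    (hbU : ENNReal.ofReal b ≤ distCompl q U / 2) {f : LegendrianGrassmannian → ℝ} {C : ℝ}
    (hf : Measurable f) (hC : ∀ P, |f P| ≤ C)
    (h0 : ∀ P, χ (gaugeAt q P.1 / b) = 0 → deriv χ (gaugeAt q P.1 / b) = 0 →
      deriv (deriv χ) (gaugeAt q P.1 / b) = 0 → f P = 0) : Integrable f v := by
  obtain ⟨d, hd, h⟩ := hχ.exists_eq_zero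
  refine integrable_of_bounded hf (measure_gaugeAt_le_lt_top hv hbU (s := d * b) (by nlinarith))
    hC fun P hP => ?_
  obtain ⟨h1, h2, h3⟩ := h (gaugeAt q P.1 / b) ((le_div_iff₀ hb).2 hP.le)
  exact h0 P h1 h2 h3

lemma integrable_integrandGauge (hχ : IsCutoff χ) (hv : IsHSLV U v) (hb : 0 < b)
    (hbU : ENNReal.ofReal b ≤ distCompl q U / 2) : Integrable (integrandGauge χ q b) v := by
  obtain ⟨K, -, hK⟩ := hχ.exists_bound
  refine integrable_of_bounded_of_eq_zero hχ hv hb hbU (measurable_integrandGauge hχ hb q)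
    (abs_integrandGauge_le hχ hK hb q) fun P _ h _ => ?_
  simp [integrandGauge, h]

lemma integrable_integrandPhase (hχ : IsCutoff χ) (hv : IsHSLV U v) (hb : 0 < b)
    (hbU : ENNReal.ofReal b ≤ distCompl q U / 2) : Integrable (integrandPhase χ q b) v := by
  obtain ⟨K, -, hK⟩ := hχ.exists_bound
  refine integrable_of_bounded_of_eq_zero hχ hv hb hbU (measurable_integrandPhase hχ hb q)
    (abs_integrandPhase_le hχ hK hb q) fun P _ h _ => ?_
  simp [integrandPhase, h]

lemma integrable_boundaryTerm (hχ : IsCutoff χ) (hv : IsHSLV U v) (hb : 0 < b)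
    (hbU : ENNReal.ofReal b ≤ distCompl q U / 2) (hε : 0 ≤ ε) :
    Integrable (boundaryTerm χ q ε b) v := by
  obtain ⟨K, -, hK⟩ := hχ.exists_bound
  refine integrable_of_bounded_of_eq_zero hχ hv hb hbU (measurable_boundaryTerm χ q ε b)
    (abs_boundaryTerm_le hχ hK hb hε q) fun P _ h h' => ?_
  simp [boundaryTerm, cutoffDeriv, cutoffDeriv₂, h, h']

lemma integrable_integrandCross (hχ : IsCutoff χ) (hv : IsHSLV U v) (hb : 0 < b)
    (hbU : ENNReal.ofReal b ≤ distCompl q U / 2) : Integrable (integrandCross χ q b) v := by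
  have e : integrandCross χ q b = fun P => 4 * (boundaryTerm χ q 0 b P + integrandGauge χ q b P
      + integrandPhase χ q b P) := funext (integrandCross_eq' hχ hb)
  rw [e]
  exact (((integrable_boundaryTerm hχ hv hb hbU le_rfl).add
    (integrable_integrandGauge hχ hv hb hbU)).add
    (integrable_integrandPhase hχ hv hb hbU)).const_mul 4

lemma preDensity_eq (χ : ℝ → ℝ) (v : Measure LegendrianGrassmannian) (q : Heis) (b : ℝ) :
    preDensity χ v q b = ∫ P, -(integrandGauge χ q b P + integrandPhase χ q b P) ∂v := by
  rw [preDensity, ← integral_const_mul]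
  refine integral_congr_ae (Eventually.of_forall fun P => ?_)
  simp only [integrandGauge, integrandPhase]
  ring

lemma Theta_eq_preDensity_add (hχ : IsCutoff χ) (hv : IsHSLV U v) (hb : 0 < b)
    (hbU : ENNReal.ofReal b ≤ distCompl q U / 2) :
    Theta χ v q b = preDensity χ v q b + (1 / 4) * ∫ P, integrandCross χ q b P ∂v := by
  rw [preDensity_eq, integral_neg, integral_add
    (integrable_integrandGauge hχ hv hb hbU) (integrable_integrandPhase hχ hv hb hbU), Theta]
  ring

lemma Theta_eq_integral_boundaryTerm (hχ : IsCutoff χ) (hv : IsHSLV U v) (hb : 0 < b)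
    (hbU : ENNReal.ofReal b ≤ distCompl q U / 2) :
    Theta χ v q b = ∫ P, boundaryTerm χ q 0 b P ∂v := by
  have hB := integrable_boundaryTerm hχ hv hb hbU le_rfl
  have hG := integrable_integrandGauge hχ hv hb hbU
  have hP := integrable_integrandPhase hχ hv hb hbU
  have e : integrandCross χ q b = fun P => 4 * (boundaryTerm χ q 0 b P + integrandGauge χ q b P
      + integrandPhase χ q b P) := funext (integrandCross_eq' hχ hb)
  rw [Theta, e, integral_const_mul, integral_add (by exact hB.add hG) hP, integral_add hB hG]
  ring

/-! ### Consequences of stationarity -/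

/-- Stationarity tested with the regularized phase, the only place where it is used directly. -/
lemma integral_boundaryTerm_eq (hχ : IsCutoff χ) (hv : IsHSLV U v) (hb : 0 < b)
    (hbU : ENNReal.ofReal b ≤ distCompl q U / 2) (hε : 0 < ε) :
    Integrable (fun P => χ (gaugeAt q P.1 / b) * phaseEnergy q ε P) v ∧
      ∫ P, boundaryTerm χ q ε b P ∂v = ∫ P, χ (gaugeAt q P.1 / b) * phaseEnergy q ε P ∂v := by
  have hint : Integrable (fun P => χ (gaugeAt q P.1 / b) * phaseEnergy q ε P) v := by
    have hχm := hχ.smooth.continuous.measurable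
    refine integrable_of_bounded_of_eq_zero hχ hv hb hbU (C := 6 / ε) (by fun_prop)
      (fun P => ?_) fun P h _ _ => by simp [h]
    have h0 := phaseEnergy_nonneg (q := q) (P := P) hε.le
    rw [abs_of_nonneg (mul_nonneg (hχ.nonneg _) h0)]
    exact (mul_le_of_le_one_left h0 (hχ.le_one _)).trans (phaseEnergy_le_div_self hε)
  refine ⟨hint, ?_⟩
  obtain ⟨d, hd, h⟩ := hχ.exists_eq_zero
  -- The radius d·b with d < 2 matters: b may be half the distance to the complement, and then the
  -- closed ball of radius 2b need not lie in `U`.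
  have hsub : Function.support (testFunction χ q ε b) ⊆ {x | gaugeAt q x ≤ d * b} := by
    intro x hx
    by_contra hlt
    refine hx ?_
    rw [testFunction, (h _ ((le_div_iff₀ hb).2 (not_le.1 hlt).le)).1, zero_mul]
  have hstat := hv.stationary (testFunction χ q ε b) (contDiff_testFunction hχ hb hε)
    (HasCompactSupport.of_support_subset_isCompact (isCompact_gaugeAt_le q (d * b)) hsub)
    ((closure_minimal hsub (isCompact_gaugeAt_le q (d * b)).isClosed).trans fun x hx =>
      gaugeAt_lt_subset hbU (lt_of_le_of_lt hx (by nlinarith)))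
  simp only [tDiv_testFunction hχ hb hε] at hstat
  rw [integral_sub (integrable_boundaryTerm hχ hv hb hbU hε.le) hint] at hstat
  linarith

/-- Dominated convergence is applied to the boundary terms, not to the energies: the energies have
no uniform bound near q, and part of their mass may concentrate there. -/
lemma tendsto_integral_cutoff_phaseEnergy (hχ : IsCutoff χ) (hv : IsHSLV U v) (hb : 0 < b)
    (hbU : ENNReal.ofReal b ≤ distCompl q U / 2) :
    Tendsto (fun n : ℕ => ∫ P, χ (gaugeAt q P.1 / b) * phaseEnergy q (1 / ((n : ℝ) + 1)) P ∂v)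
      atTop (𝓝 (Theta χ v q b)) := by
  obtain ⟨K, hK0, hK⟩ := hχ.exists_bound
  obtain ⟨d, hd, h⟩ := hχ.exists_eq_zero
  have hfin := measure_gaugeAt_le_lt_top (q := q) hv hbU (s := d * b) (by nlinarith)
  have e : ∀ n : ℕ, ∫ P, χ (gaugeAt q P.1 / b) * phaseEnergy q (1 / ((n : ℝ) + 1)) P ∂v =
      ∫ P, boundaryTerm χ q (1 / ((n : ℝ) + 1)) b P ∂v := fun n =>
    (integral_boundaryTerm_eq hχ hv hb hbU (by positivity)).2.symm
  simp only [e]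
  rw [Theta_eq_integral_boundaryTerm hχ hv hb hbU]
  refine tendsto_integral_of_dominated_convergence
    ({P | gaugeAt q P.1 ≤ d * b}.indicator fun _ => 11 * K / b ^ 2) (fun n => ?_) ?_
    (fun n => Eventually.of_forall fun P => ?_) (Eventually.of_forall fun P => ?_)
  · exact (measurable_boundaryTerm χ q _ b).aestronglyMeasurable
  · exact (integrable_indicator_iff (measurableSet_gaugeAt_le q _)).2
      (integrableOn_const hfin.ne)
  · by_cases hP : gaugeAt q P.1 ≤ d * b
    · rw [indicator_of_mem (by exact hP)]
      exact abs_boundaryTerm_le hχ hK hb (by positivity) q P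
    · rw [indicator_of_notMem (by exact hP)]
      obtain ⟨-, h2, h3⟩ := h _ ((le_div_iff₀ hb).2 (not_le.1 hP).le)
      simp [boundaryTerm, cutoffDeriv, cutoffDeriv₂, h2, h3]
  · exact (tendsto_boundaryTerm hχ P).comp tendsto_one_div_add_atTop_nhds_zero_nat

lemma Theta_nonneg (hχ : IsCutoff χ) (hv : IsHSLV U v) (hb : 0 < b)
    (hbU : ENNReal.ofReal b ≤ distCompl q U / 2) : 0 ≤ Theta χ v q b :=
  ge_of_tendsto' (tendsto_integral_cutoff_phaseEnergy hχ hv hb hbU) fun n =>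
    integral_nonneg fun P => mul_nonneg (hχ.nonneg _) (phaseEnergy_nonneg (by positivity))

/-! ### Monotonicity of Θ^χ and its bound by the mass of an annulus. -/

lemma cutoff_sub_nonneg (hχ : IsCutoff χ) (ha : 0 < a) (hab : a ≤ b) (q x : Heis) :
    0 ≤ χ (gaugeAt q x / b) - χ (gaugeAt q x / a) :=
  sub_nonneg.2 (hχ.antitone (div_le_div_of_nonneg_left (gaugeAt_nonneg q x) ha hab))

lemma cutoff_sub_mul_phaseEnergy_le (hχ : IsCutoff χ) (ha : 0 < a) (hab : a ≤ b) (hε : 0 ≤ ε)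
    (q : Heis) (P : LegendrianGrassmannian) :
    |(χ (gaugeAt q P.1 / b) - χ (gaugeAt q P.1 / a)) * phaseEnergy q ε P| ≤ 6 / a ^ 2 := by
  have h0 := phaseEnergy_nonneg (q := q) (P := P) hε
  have h1 := cutoff_sub_nonneg hχ ha hab q P.1
  rw [abs_of_nonneg (mul_nonneg h1 h0)]
  rcases le_or_gt (gaugeAt q P.1) a with h | h
  · rw [hχ.eq_one _ ((div_le_one (ha.trans_le hab)).2 (h.trans hab)),
      hχ.eq_one _ ((div_le_one ha).2 h), sub_self, zero_mul]
    positivity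
  · have h2 : χ (gaugeAt q P.1 / b) - χ (gaugeAt q P.1 / a) ≤ 1 := by
      linarith [hχ.le_one (gaugeAt q P.1 / b), hχ.nonneg (gaugeAt q P.1 / a)]
    refine (mul_le_of_le_one_left h0 h2).trans
      ((phaseEnergy_le hε (ha.trans h)).trans ?_)
    gcongr

lemma integrable_cutoff_sub_mul_phaseEnergy (hχ : IsCutoff χ) (hv : IsHSLV U v) (ha : 0 < a)
    (hab : a ≤ b) (hbU : ENNReal.ofReal b ≤ distCompl q U / 2) :
    Integrable (fun P => (χ (gaugeAt q P.1 / b) - χ (gaugeAt q P.1 / a)) * phaseEnergy q 0 P) v := by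
  have hχm := hχ.smooth.continuous.measurable
  refine integrable_of_bounded_of_eq_zero hχ hv (ha.trans_le hab) hbU (C := 6 / a ^ 2)
    (by fun_prop) (cutoff_sub_mul_phaseEnergy_le hχ ha hab le_rfl q) fun P h _ _ => ?_
  have h1 := cutoff_sub_nonneg hχ ha hab q P.1
  have h2 := hχ.nonneg (gaugeAt q P.1 / a)
  rw [h] at h1 ⊢
  rw [show χ (gaugeAt q P.1 / a) = 0 by linarith, sub_zero, zero_mul]

/-- The difference of the cut-offs vanishes for 𝔯 ≤ a, where the energies could blow up; elsewhere
they are at most 6/a². The limit ε → 0 can thus be taken inside the integral and no concentrated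
mass is lost. -/
theorem Theta_sub_Theta (hχ : IsCutoff χ) (hv : IsHSLV U v) (ha : 0 < a) (hab : a ≤ b)
    (hbU : ENNReal.ofReal b ≤ distCompl q U / 2) :
    Theta χ v q b - Theta χ v q a =
      ∫ P, (χ (gaugeAt q P.1 / b) - χ (gaugeAt q P.1 / a)) * phaseEnergy q 0 P ∂v := by
  have hb : 0 < b := ha.trans_le hab
  have haU : ENNReal.ofReal a ≤ distCompl q U / 2 := (ENNReal.ofReal_le_ofReal hab).trans hbU
  obtain ⟨d, hd, h⟩ := hχ.exists_eq_zero
  have hfin := measure_gaugeAt_le_lt_top (q := q) hv hbU (s := d * b) (by nlinarith)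
  have hχm := hχ.smooth.continuous.measurable
  refine tendsto_nhds_unique ((tendsto_integral_cutoff_phaseEnergy hχ hv hb hbU).sub
    (tendsto_integral_cutoff_phaseEnergy hχ hv ha haU)) ?_
  have e : ∀ n : ℕ, ∫ P, χ (gaugeAt q P.1 / b) * phaseEnergy q (1 / ((n : ℝ) + 1)) P ∂v
      - ∫ P, χ (gaugeAt q P.1 / a) * phaseEnergy q (1 / ((n : ℝ) + 1)) P ∂v =
      ∫ P, (χ (gaugeAt q P.1 / b) - χ (gaugeAt q P.1 / a)) *
        phaseEnergy q (1 / ((n : ℝ) + 1)) P ∂v := fun n => by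
    rw [← integral_sub (integral_boundaryTerm_eq hχ hv hb hbU (by positivity)).1
      (integral_boundaryTerm_eq hχ hv ha haU (by positivity)).1]
    simp only [sub_mul]
  simp only [e]
  refine tendsto_integral_of_dominated_convergence
    ({P | gaugeAt q P.1 ≤ d * b}.indicator fun _ => 6 / a ^ 2) (fun n => ?_) ?_
    (fun n => Eventually.of_forall fun P => ?_) (Eventually.of_forall fun P => ?_)
  · exact Measurable.aestronglyMeasurable (by fun_prop)
  · exact (integrable_indicator_iff (measurableSet_gaugeAt_le q _)).2
      (integrableOn_const hfin.ne)
  · by_cases hP : gaugeAt q P.1 ≤ d * b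
    · rw [indicator_of_mem (by exact hP)]
      exact cutoff_sub_mul_phaseEnergy_le hχ ha hab (by positivity) q P
    · rw [indicator_of_notMem (by exact hP)]
      have h1 := cutoff_sub_nonneg hχ ha hab q P.1
      have h2 := hχ.nonneg (gaugeAt q P.1 / a)
      rw [(h _ ((le_div_iff₀ hb).2 (not_le.1 hP).le)).1] at h1 ⊢
      rw [show χ (gaugeAt q P.1 / a) = 0 by linarith]
      simp
  · rcases (gaugeAt_nonneg q P.1).eq_or_lt with hr | hr
    -- At q both cut-offs take the value χ(0), so the integrand is 0 whatever the energy is there.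
    · simp [← hr]
    · exact ((tendsto_phaseEnergy hr).comp tendsto_one_div_add_atTop_nhds_zero_nat).const_mul _

lemma Theta_mono (hχ : IsCutoff χ) (hv : IsHSLV U v) (ha : 0 < a) (hab : a ≤ b)
    (hbU : ENNReal.ofReal b ≤ distCompl q U / 2) : Theta χ v q a ≤ Theta χ v q b := by
  rw [← sub_nonneg, Theta_sub_Theta hχ hv ha hab hbU]
  exact integral_nonneg fun P =>
    mul_nonneg (cutoff_sub_nonneg hχ ha hab q P.1) (phaseEnergy_nonneg le_rfl)

lemma ofReal_Theta_le {K : ℝ} (hχ : IsCutoff χ)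
    (hK : ∀ t, |deriv χ t| ≤ K ∧ |deriv (deriv χ) t| ≤ K) (hv : IsHSLV U v) (hb : 0 < b)
    (hbU : ENNReal.ofReal b ≤ distCompl q U / 2) :
    ENNReal.ofReal (Theta χ v q b) ≤
      ENNReal.ofReal (11 * K * b⁻¹ ^ 2) * weight v {p | b < dK q p ∧ dK q p < 2 * b} := by
  have hmeas : MeasurableSet {p | b < dK q p ∧ dK q p < 2 * b} :=
    ((isOpen_lt continuous_const (continuous_gaugeAt q)).inter
      (isOpen_lt (continuous_gaugeAt q) continuous_const)).measurableSet
  rw [weight, Measure.map_apply measurable_fst hmeas, Theta_eq_integral_boundaryTerm hχ hv hb hbU]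
  set A : Set LegendrianGrassmannian := Prod.fst ⁻¹' {p | b < dK q p ∧ dK q p < 2 * b} with hA
  have hAm : MeasurableSet A := measurable_fst hmeas
  calc ENNReal.ofReal (∫ P, boundaryTerm χ q 0 b P ∂v)
      ≤ ‖∫ P, boundaryTerm χ q 0 b P ∂v‖ₑ := by
        rw [← ofReal_norm]
        exact ENNReal.ofReal_le_ofReal (le_abs_self _)
    _ ≤ ∫⁻ P, ‖boundaryTerm χ q 0 b P‖ₑ ∂v := enorm_integral_le_lintegral_enorm _
    _ ≤ ∫⁻ P, A.indicator (fun _ => ENNReal.ofReal (11 * K * b⁻¹ ^ 2)) P ∂v := by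
        refine lintegral_mono fun P => ?_
        by_cases hP : P ∈ A
        · rw [indicator_of_mem hP, ← ofReal_norm]
          refine ENNReal.ofReal_le_ofReal ?_
          have := abs_boundaryTerm_le hχ hK hb le_rfl q P
          rwa [inv_pow, ← div_eq_mul_inv]
        · have h0 : gaugeAt q P.1 / b ∉ Ioo (1 : ℝ) 2 := fun h' =>
            hP ⟨(one_lt_div hb).1 h'.1, (div_lt_iff₀ hb).1 h'.2⟩
          simp [boundaryTerm_eq_zero hχ h0]
    _ = _ := by rw [lintegral_indicator_const hAm]

/-! ### The density -/

lemma height_mul_phase_nonneg (q : Heis) (ε : ℝ) (x : Heis) : 0 ≤ height q x * phase q ε x := by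
  rcases le_or_gt 0 (height q x) with h | h
  · exact mul_nonneg h (Complex.arg_nonneg_iff.2 h)
  · exact mul_nonneg_of_nonpos_of_nonpos h.le (Complex.arg_neg_iff.2 h).le

/-- Product rule for the bracket 𝔯⁻³ a⁻¹ χ'(𝔯/a) · arctan σ, separating the derivative of arctan σ
from that of the radial factor. -/
lemma integrandCross_eq_phaseEnergy_add (hχ : IsCutoff χ) (ha : 0 < a) (hr : 0 < gaugeAt q P.1) :
    (1 / 4) * integrandCross χ q a P =
      gaugeAt q P.1 * deriv χ (gaugeAt q P.1 / a) / (4 * a) * phaseEnergy q 0 P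
        + phase q 0 P.1 * (tGrad (arctanPhaseAt q) P ⬝ᵥ tGrad (gaugeAt q) P) *
          (gaugeAt q P.1 / (4 * a) * (deriv (deriv χ) (gaugeAt q P.1 / a) / a
            - 3 * deriv χ (gaugeAt q P.1 / a) / gaugeAt q P.1)) := by
  have hu := hasRHDeriv_phase le_rfl (Or.inl hr)
  have hg := hasRHDeriv_gaugeAt hr
  have hN := modSq_pos le_rfl (Or.inl hr)
  have hf : (fun x => (gaugeAt q x ^ 3)⁻¹ * (a⁻¹ * deriv χ (gaugeAt q x / a)) * arctanPhaseAt q x)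
      = fun x => 2 * cutoffDeriv χ a (gaugeAt q x) * phase q 0 x := by
    funext y
    rw [arctanPhaseAt_eq_phase, cutoffDeriv]
    rcases (gaugeAt_nonneg q y).eq_or_lt with h | h
    · rw [← h]; simp
    · field_simp
  have hprod := ((HasRHDeriv.const 2).mul (hasRHDeriv_cutoffDeriv hχ ha q P.1)).mul hu
  rw [integrandCross, hf, phaseEnergy_zero hr, arctanPhaseAt_eq_phase,
    hu.tGrad_dotProduct_tGrad hprod, hu.tGrad_dotProduct_tGrad hu, hu.tGrad_dotProduct_tGrad hg,
    cutoffDeriv, cutoffDeriv₂]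
  field_simp
  ring

/-- The phase part has a sign, since φ and arctan σ have the same sign, and can be dropped. What is
left controls η²|∇^𝒫 𝔯|², the quantity needed to absorb the cross term. -/
lemma density_integrand_ge (ha : 0 < a) {e : ℝ} (he : deriv χ (gaugeAt q P.1 / a) = -e ^ 2)
    (hr : 0 < gaugeAt q P.1) (hra : gaugeAt q P.1 < 2 * a) :
    (tGrad (gaugeAt q) P ⬝ᵥ tGrad (gaugeAt q) P) * e ^ 2 / (2 * a ^ 2) ≤
      -(integrandGauge χ q a P + integrandPhase χ q a P) := by
  have hG0 : 0 ≤ tGrad (gaugeAt q) P ⬝ᵥ tGrad (gaugeAt q) P :=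
    Finset.sum_nonneg fun i _ => mul_self_nonneg _
  have hp : integrandPhase χ q a P ≤ 0 := by
    rw [integrandPhase_eq ha hr, cutoffDeriv, he]
    have h0 := height_mul_phase_nonneg q 0 P.1
    have : 2 * (-e ^ 2 / a / (2 * gaugeAt q P.1 ^ 3)) * height q P.1 * phase q 0 P.1
        = -(e ^ 2 / (a * gaugeAt q P.1 ^ 3) * (height q P.1 * phase q 0 P.1)) := by field_simp
    rw [this, neg_nonpos]
    positivity
  have hg : integrandGauge χ q a P =
      -((tGrad (gaugeAt q) P ⬝ᵥ tGrad (gaugeAt q) P) * e ^ 2 / (gaugeAt q P.1 * a)) := by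
    rw [integrandGauge, he]
    field_simp
  have : (tGrad (gaugeAt q) P ⬝ᵥ tGrad (gaugeAt q) P) * e ^ 2 / (2 * a ^ 2) ≤
      (tGrad (gaugeAt q) P ⬝ᵥ tGrad (gaugeAt q) P) * e ^ 2 / (gaugeAt q P.1 * a) := by
    have : gaugeAt q P.1 * a ≤ 2 * a ^ 2 := by nlinarith
    gcongr
  linarith

/-- Here u = arctan σ, V = |∇^𝒫 u|², G = |∇^𝒫 𝔯|², X = ∇^𝒫 u · ∇^𝒫 𝔯, and e, e' are the values of η,
η'. The mixed summand is at most 4K|X||e|/a; with X² ≤ VG, the arithmetic–geometric mean inequality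
splits it into δGe²/(2a²) + 8K²V/δ. The pure energy summand raises 8 to 9. -/
lemma abs_cross_le {r u X V G e e' K δ D : ℝ} (ha : 0 < a) (har : a < r) (hra : r < 2 * a)
    (hu : |u| ≤ 2) (he : |e| ≤ K) (he' : |e'| ≤ K) (hV : 0 ≤ V) (hG : 0 ≤ G)
    (hX : X ^ 2 ≤ V * G) (hδ : 0 < δ) (hδ1 : δ ≤ 1) (hD : G * e ^ 2 / (2 * a ^ 2) ≤ D) :
    |r * -e ^ 2 / (4 * a) * V + u * X * (r / (4 * a) * (-(2 * e * e') / a - 3 * -e ^ 2 / r))| ≤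
      δ * D + 9 * K ^ 2 / δ * V := by
  have hr : 0 < r := ha.trans har
  have hK : 0 ≤ K := (abs_nonneg _).trans he
  have hcoef : |3 * e / (4 * a) - r / (2 * a) * e' / a| ≤ 2 * K / a := by
    have b1 : |3 * e / (4 * a)| ≤ 3 * K / (4 * a) := by
      rw [abs_div, abs_mul, abs_of_pos (by positivity : 0 < 4 * a),
        abs_of_pos (by norm_num : (0 : ℝ) < 3)]
      gcongr
    have b2 : |r / (2 * a) * e' / a| ≤ 1 * K / a := by
      rw [abs_div, abs_mul, abs_of_pos ha, abs_of_pos (by positivity : 0 < r / (2 * a))]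
      have : r / (2 * a) ≤ 1 := (div_le_one (by positivity)).2 hra.le
      gcongr
    have b3 : 3 * K / (4 * a) + 1 * K / a = 2 * K / a - K / (4 * a) := by field_simp; ring
    have b4 : 0 ≤ K / (4 * a) := by positivity
    linarith [abs_sub (3 * e / (4 * a)) (r / (2 * a) * e' / a)]
  have hsecond : |u * X * (r / (4 * a) * (-(2 * e * e') / a - 3 * -e ^ 2 / r))| ≤
      δ * (G * e ^ 2 / (2 * a ^ 2)) + 8 * K ^ 2 / δ * V := by
    have s0 : r / (4 * a) * (-(2 * e * e') / a - 3 * -e ^ 2 / r) =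
        e * (3 * e / (4 * a) - r / (2 * a) * e' / a) := by field_simp; ring
    have s1 : |u * X * (r / (4 * a) * (-(2 * e * e') / a - 3 * -e ^ 2 / r))| ≤
        2 * |X| * (|e| * (2 * K / a)) := by
      rw [s0, abs_mul, abs_mul, abs_mul e]
      gcongr
    refine s1.trans (le_of_abs_le (abs_le_of_sq_le_sq ?_ (by positivity)))
    calc (2 * |X| * (|e| * (2 * K / a))) ^ 2 = X ^ 2 * (16 * e ^ 2 * K ^ 2 / a ^ 2) := by
          simp only [mul_pow, div_pow, sq_abs]; ring
      _ ≤ V * G * (16 * e ^ 2 * K ^ 2 / a ^ 2) := mul_le_mul_of_nonneg_right hX (by positivity)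
      _ = 4 * (δ * (G * e ^ 2 / (2 * a ^ 2))) * (8 * K ^ 2 / δ * V) := by field_simp; ring
      _ ≤ _ := four_mul_le_sq_add _ _
  have hfirst : |r * -e ^ 2 / (4 * a) * V| ≤ K ^ 2 / δ * V := by
    have f0 : r * -e ^ 2 / (4 * a) = -(r / (4 * a) * e ^ 2) := by ring
    rw [f0, abs_mul, abs_neg, abs_of_nonneg hV, abs_of_nonneg (by positivity)]
    have f1 : e ^ 2 ≤ K ^ 2 := by
      rw [← sq_abs e]; exact pow_le_pow_left₀ (abs_nonneg _) he 2
    have f2 : r / (4 * a) ≤ 1 := (div_le_one (by positivity)).2 (by linarith)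
    have f3 : K ^ 2 ≤ K ^ 2 / δ := le_div_self (sq_nonneg K) hδ hδ1
    have f4 : r / (4 * a) * e ^ 2 ≤ 1 * K ^ 2 := by gcongr
    exact mul_le_mul_of_nonneg_right (by linarith) hV
  refine (abs_add_le _ _).trans ((add_le_add hfirst hsecond).trans ?_)
  have g1 := mul_le_mul_of_nonneg_left hD hδ.le
  have g2 : 9 * K ^ 2 / δ * V = K ^ 2 / δ * V + 8 * K ^ 2 / δ * V := by ring
  linarith

/-- The cross term in `Θ^χ` is controlled by the density integrand and by the energy of the
phase. -/
lemma exists_abs_integrandCross_le (hχ : IsCutoff χ) :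
    ∃ M : ℝ, 0 ≤ M ∧ ∀ (q : Heis) (a δ : ℝ) (P : LegendrianGrassmannian), 0 < a → 0 < δ → δ ≤ 1 →
      |(1 / 4) * integrandCross χ q a P| ≤
        δ * -(integrandGauge χ q a P + integrandPhase χ q a P)
        + M / δ * ((χ (gaugeAt q P.1 / (2 * a)) - χ (gaugeAt q P.1 / (a / 2)))
          * phaseEnergy q 0 P) := by
  obtain ⟨η, K, hK, h₁, h₂, h₃, h₄⟩ := hχ.exists_sqrt
  refine ⟨9 * K ^ 2, by positivity, fun q a δ P ha hδ hδ1 => ?_⟩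
  have hV := phaseEnergy_nonneg (q := q) (P := P) (ε := 0) le_rfl
  by_cases hmem : gaugeAt q P.1 / a ∈ Ioo (1 : ℝ) 2
  swap
  · rw [integrandCross_eq' hχ ha, boundaryTerm_eq_zero hχ hmem, (integrands_eq_zero hχ hmem).1,
      (integrands_eq_zero hχ hmem).2]
    have := cutoff_sub_nonneg hχ (half_pos ha) (b := 2 * a) (by linarith) q P.1
    simp only [add_zero, mul_zero, abs_zero, neg_zero, zero_add]
    positivity
  have har : a < gaugeAt q P.1 := (one_lt_div ha).1 hmem.1
  have hra : gaugeAt q P.1 < 2 * a := (div_lt_iff₀ ha).1 hmem.2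
  have hr : 0 < gaugeAt q P.1 := ha.trans har
  -- The radii 2a and a/2 are chosen so that the cut-off difference is 1 on a < 𝔯 < 2a; its energy
  -- integral is then Θ^χ(q, 2a) - Θ^χ(q, a/2).
  have hcut : χ (gaugeAt q P.1 / (2 * a)) - χ (gaugeAt q P.1 / (a / 2)) = 1 := by
    rw [hχ.eq_one _ ((div_le_one (by positivity)).2 hra.le), hχ.eq_zero, sub_zero]
    rw [le_div_iff₀ (by positivity)]; linarith
  have hCS : (tGrad (arctanPhaseAt q) P ⬝ᵥ tGrad (gaugeAt q) P) ^ 2 ≤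
      phaseEnergy q 0 P * (tGrad (gaugeAt q) P ⬝ᵥ tGrad (gaugeAt q) P) := by
    rw [phaseEnergy_zero hr]
    simp only [dotProduct, ← sq]
    exact Finset.sum_mul_sq_le_sq_mul_sq _ _ _
  rw [hcut, one_mul, integrandCross_eq_phaseEnergy_add hχ ha hr, h₁, h₂]
  exact abs_cross_le ha har hra (abs_phase_le le_rfl q P.1) (h₃ _).1 (h₃ _).2 hV
    (Finset.sum_nonneg fun i _ => mul_self_nonneg _) hCS hδ hδ1
    (density_integrand_ge ha (h₁ _) hr hra)

/-- Two quantities that differ by a small multiple of the second one plus a vanishing error have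
the same limit. -/
lemma tendsto_of_abs_sub_le_mul_add {ι : Type*} {l : Filter ι} {T A E : ι → ℝ} {θ M : ℝ}
    (hT : Tendsto T l (𝓝 θ)) (hE : Tendsto E l (𝓝 0))
    (h : ∀ᶠ i in l, ∀ δ, 0 < δ → δ ≤ 1 → |T i - A i| ≤ δ * A i + M / δ * E i) :
    Tendsto A l (𝓝 θ) := by
  -- Taking δ = 1/2 absorbs half of A and bounds it from above; only then can δ be made small.
  have hA : ∀ᶠ i in l, A i ≤ 2 * |θ| + 4 := by
    have h1 : ∀ᶠ i in l, T i < |θ| + 1 := hT.eventually_lt_const (by linarith [le_abs_self θ])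
    have h2 : ∀ᶠ i in l, M / (1 / 2) * E i < 1 :=
      (by simpa using hE.const_mul (M / (1 / 2)) :
        Tendsto (fun i => M / (1 / 2) * E i) l (𝓝 0)).eventually_lt_const one_pos
    filter_upwards [h, h1, h2] with i hi h1 h2
    have := neg_le_of_abs_le (hi (1 / 2) (by norm_num) (by norm_num))
    linarith
  have hTA : Tendsto (fun i => T i - A i) l (𝓝 0) := by
    rw [Metric.tendsto_nhds]
    intro ρ hρ
    set B := 2 * |θ| + 4 with hB
    have hBpos : 0 < B := by positivity
    set δ := min 1 (ρ / (2 * B)) with hδ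
    have hδ0 : 0 < δ := by positivity
    have h2 : ∀ᶠ i in l, M / δ * E i < ρ / 2 :=
      (by simpa using hE.const_mul (M / δ) :
        Tendsto (fun i => M / δ * E i) l (𝓝 0)).eventually_lt_const (half_pos hρ)
    filter_upwards [h, hA, h2] with i hi hA h2
    have h3 := hi δ hδ0 (min_le_left _ _)
    have h4 : δ * A i ≤ ρ / 2 := by
      calc δ * A i ≤ δ * B := mul_le_mul_of_nonneg_left hA hδ0.le
        _ ≤ ρ / (2 * B) * B := mul_le_mul_of_nonneg_right (min_le_right _ _) hBpos.le
        _ = ρ / 2 := by field_simp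
    rw [dist_zero_right, Real.norm_eq_abs]
    linarith
  simpa using hT.sub hTA

lemma exists_abs_Theta_sub_preDensity_le (hχ : IsCutoff χ) :
    ∃ M : ℝ, ∀ (U : Set Heis) (v : Measure LegendrianGrassmannian), IsHSLV U v →
      ∀ (q : Heis) (a : ℝ), 0 < a → ENNReal.ofReal (2 * a) ≤ distCompl q U / 2 →
      ∀ δ, 0 < δ → δ ≤ 1 → |Theta χ v q a - preDensity χ v q a| ≤
        δ * preDensity χ v q a + M / δ * (Theta χ v q (2 * a) - Theta χ v q (a / 2)) := by
  obtain ⟨M, -, h⟩ := exists_abs_integrandCross_le hχ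
  refine ⟨M, fun U v hv q a ha haU δ hδ hδ1 => ?_⟩
  have haU' : ENNReal.ofReal a ≤ distCompl q U / 2 :=
    (ENNReal.ofReal_le_ofReal (by linarith)).trans haU
  have hD : Integrable (fun P => -(integrandGauge χ q a P + integrandPhase χ q a P)) v :=
    ((integrable_integrandGauge hχ hv ha haU').add (integrable_integrandPhase hχ hv ha haU')).neg
  have hE := integrable_cutoff_sub_mul_phaseEnergy hχ hv (half_pos ha)
    (by linarith : a / 2 ≤ 2 * a) haU
  rw [Theta_eq_preDensity_add hχ hv ha haU', add_sub_cancel_left,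
    Theta_sub_Theta hχ hv (half_pos ha) (by linarith) haU, preDensity_eq,
    ← integral_const_mul, ← integral_const_mul, ← integral_const_mul]
  rw [← integral_add (hD.const_mul δ) (hE.const_mul (M / δ))]
  refine (abs_integral_le_integral_abs).trans (integral_mono ?_ ?_ fun P => h q a δ P ha hδ hδ1)
  · exact ((integrable_integrandCross hχ hv ha haU').const_mul _).abs
  · exact (hD.const_mul δ).add (hE.const_mul (M / δ))

/-! ### The limit of Θ^χ at 0 and the energy inequality. -/

lemma exists_pos_ofReal_le_distCompl (hU : IsOpen U) (hq : q ∈ U) :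
    ∃ b > 0, ENNReal.ofReal b ≤ distCompl q U / 2 := by
  obtain ⟨δ, hδ, h⟩ := exists_gaugeAt_lt_subset hU hq
  refine ⟨δ / 2, half_pos hδ, ?_⟩
  rw [ENNReal.ofReal_div_of_pos two_pos, ENNReal.ofReal_ofNat]
  refine ENNReal.div_le_div_right (le_iInf₂ fun p hp => ENNReal.ofReal_le_ofReal ?_) 2
  by_contra hlt
  exact hp (h p (not_le.1 hlt))

lemma exists_tendsto_Theta (hχ : IsCutoff χ) (hv : IsHSLV U v) (hU : IsOpen U) (hq : q ∈ U) :
    ∃ θ, 0 ≤ θ ∧ Tendsto (Theta χ v q) (𝓝[>] 0) (𝓝 θ) ∧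
      ∀ a, 0 < a → ENNReal.ofReal a ≤ distCompl q U / 2 → θ ≤ Theta χ v q a := by
  obtain ⟨b, hb, hbU⟩ := exists_pos_ofReal_le_distCompl hU hq
  have hadm : ∀ a, a ≤ b → ENNReal.ofReal a ≤ distCompl q U / 2 := fun a ha =>
    (ENNReal.ofReal_le_ofReal ha).trans hbU
  have hbdd : BddBelow (Theta χ v q '' Ioc 0 b) :=
    ⟨0, by rintro _ ⟨a, ha, rfl⟩; exact Theta_nonneg hχ hv ha.1 (hadm a ha.2)⟩
  have hne : (Theta χ v q '' Ioc 0 b).Nonempty := ⟨_, b, ⟨hb, le_rfl⟩, rfl⟩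
  refine ⟨sInf (Theta χ v q '' Ioc 0 b), le_csInf hne ?_, ?_, fun a ha haU => ?_⟩
  · rintro _ ⟨a, ha, rfl⟩
    exact Theta_nonneg hχ hv ha.1 (hadm a ha.2)
  · rw [tendsto_order]
    constructor
    · intro c hc
      filter_upwards [Ioc_mem_nhdsGT hb] with a ha
      exact hc.trans_le (csInf_le hbdd ⟨a, ha, rfl⟩)
    · intro c hc
      obtain ⟨_, ⟨a, ha, rfl⟩, hac⟩ := exists_lt_of_csInf_lt hne hc
      filter_upwards [Ioc_mem_nhdsGT ha.1] with s hs
      exact (Theta_mono hχ hv hs.1 hs.2 (hadm a ha.2)).trans_lt hac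
  · have h1 : 0 < min a b := lt_min ha hb
    exact (csInf_le hbdd ⟨min a b, ⟨h1, min_le_right _ _⟩, rfl⟩).trans
      (Theta_mono hχ hv h1 (min_le_left _ _) haU)

/-- The punctured ball is exhausted by the annuli s < 𝔯 < b. On each, the cut-off difference for
radii b and s/2 equals 1, so the energy is at most Θ^χ(q, b) - Θ^χ(q, s/2), and θ ≤ Θ^χ(q, s/2). -/
lemma ofReal_add_lintegral_le (hχ : IsCutoff χ) (hv : IsHSLV U v) {θ : ℝ}
    (hθ : ∀ a, 0 < a → ENNReal.ofReal a ≤ distCompl q U / 2 → θ ≤ Theta χ v q a)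
    (hb : 0 < b) (hbU : ENNReal.ofReal b ≤ distCompl q U / 2) :
    ENNReal.ofReal θ + ∫⁻ P in {P | 0 < gaugeAt q P.1 ∧ gaugeAt q P.1 < b},
      ENNReal.ofReal (tGrad (arctanPhaseAt q) P ⬝ᵥ tGrad (arctanPhaseAt q) P) ∂v
      ≤ ENNReal.ofReal (Theta χ v q b) := by
  have hmeas : ∀ s, MeasurableSet {P : LegendrianGrassmannian | s < gaugeAt q P.1 ∧
      gaugeAt q P.1 < b} := fun s =>
    (measurableSet_lt measurable_const (measurable_gaugeAt q)).inter
      (measurableSet_lt (measurable_gaugeAt q) measurable_const)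
  rw [setLIntegral_congr_fun (g := fun P => ENNReal.ofReal (phaseEnergy q 0 P)) (hmeas 0)
    fun P hP => by simp only [phaseEnergy_zero hP.1]]
  let s : ℕ → ℝ := fun n => b / ((n : ℝ) + 1)
  have hs0 : ∀ n, 0 < s n := fun n => by positivity
  have hsb : ∀ n, s n ≤ b := fun n => div_le_self hb.le (by linarith [n.cast_nonneg (α := ℝ)])
  have hUnion : {P : LegendrianGrassmannian | 0 < gaugeAt q P.1 ∧ gaugeAt q P.1 < b} =
      ⋃ n, {P | s n < gaugeAt q P.1 ∧ gaugeAt q P.1 < b} := by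
    ext P
    simp only [mem_iUnion, mem_ofPred_eq]
    constructor
    · rintro ⟨h1, h2⟩
      obtain ⟨n, hn⟩ := exists_nat_gt (b / gaugeAt q P.1)
      refine ⟨n, ?_, h2⟩
      rw [div_lt_iff₀ h1] at hn
      rw [div_lt_iff₀ (by positivity)]
      nlinarith
    · rintro ⟨n, h1, h2⟩
      exact ⟨(hs0 n).trans h1, h2⟩
  have hmono : Monotone fun n => {P : LegendrianGrassmannian | s n < gaugeAt q P.1 ∧
      gaugeAt q P.1 < b} := by
    intro m n hmn P hP
    refine ⟨lt_of_le_of_lt ?_ hP.1, hP.2⟩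
    have : (m : ℝ) ≤ n := Nat.cast_le.2 hmn
    simp only [s]
    gcongr
  rw [hUnion, setLIntegral_iUnion_of_directed _ hmono.directed_le, ENNReal.add_iSup]
  refine iSup_le fun n => ?_
  have ha : 0 < s n / 2 := half_pos (hs0 n)
  have hab : s n / 2 ≤ b := by linarith [hsb n, hs0 n]
  have haU : ENNReal.ofReal (s n / 2) ≤ distCompl q U / 2 :=
    (ENNReal.ofReal_le_ofReal hab).trans hbU
  have h1 : ∫⁻ P in {P | s n < gaugeAt q P.1 ∧ gaugeAt q P.1 < b},
      ENNReal.ofReal (phaseEnergy q 0 P) ∂v ≤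
      ENNReal.ofReal (Theta χ v q b - Theta χ v q (s n / 2)) := by
    rw [Theta_sub_Theta hχ hv ha hab hbU, ofReal_integral_eq_lintegral_ofReal
      (integrable_cutoff_sub_mul_phaseEnergy hχ hv ha hab hbU)
      (Eventually.of_forall fun P =>
        mul_nonneg (cutoff_sub_nonneg hχ ha hab q P.1) (phaseEnergy_nonneg le_rfl)),
      ← lintegral_indicator (hmeas _)]
    refine lintegral_mono fun P => ?_
    by_cases hP : P ∈ {P : LegendrianGrassmannian | s n < gaugeAt q P.1 ∧ gaugeAt q P.1 < b}
    · rw [indicator_of_mem hP, hχ.eq_one _ ((div_le_one hb).2 hP.2.le), hχ.eq_zero, sub_zero, one_mul]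
      rw [le_div_iff₀ ha]; linarith [hP.1]
    · rw [indicator_of_notMem hP]; exact zero_le
  calc _ ≤ ENNReal.ofReal (Theta χ v q (s n / 2))
        + ENNReal.ofReal (Theta χ v q b - Theta χ v q (s n / 2)) :=
        add_le_add (ENNReal.ofReal_le_ofReal (hθ _ ha haU)) h1
    _ = _ := by
      rw [← ENNReal.ofReal_add (Theta_nonneg hχ hv ha haU)
        (sub_nonneg.2 (Theta_mono hχ hv ha hab hbU)), add_sub_cancel]

end

end Heisenberg

end

/-! ### Assembly of the monotonicity formula. -/

theorem mainTheorem5 (χ : ℝ → ℝ) (hχ : Heisenberg.IsCutoff χ) :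
    ∃ C : ℝ, 0 < C ∧
      ∀ (U : Set Heisenberg.Heis) (_hU : IsOpen U)
        (v : Measure Heisenberg.LegendrianGrassmannian) (_hv : Heisenberg.IsHSLV U v)
        (q : Heisenberg.Heis) (_hq : q ∈ U),
        -- the integrals that define `Θ^χ(q, a)` converge absolutely
        (∀ a : ℝ, 0 < a → ENNReal.ofReal a ≤ Heisenberg.distCompl q U / 2 →
          Integrable (Heisenberg.integrandGauge χ q a) v ∧
          Integrable (Heisenberg.integrandPhase χ q a) v ∧
          Integrable (Heisenberg.integrandCross χ q a) v) ∧
        -- monotonicity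
        (∀ a b : ℝ, 0 < a → a < b → ENNReal.ofReal b ≤ Heisenberg.distCompl q U / 2 →
          0 ≤ Heisenberg.Theta χ v q a ∧ Heisenberg.Theta χ v q a ≤ Heisenberg.Theta χ v q b) ∧
        -- existence of the density and the bound
        ∃ θ : ℝ, 0 ≤ θ ∧
          Tendsto (fun ε : ℝ => Heisenberg.preDensity χ v q ε) (𝓝[>] 0) (𝓝 θ) ∧
          Tendsto (fun ε : ℝ => Heisenberg.Theta χ v q ε) (𝓝[>] 0) (𝓝 θ) ∧
          ∀ b : ℝ, 0 < b → ENNReal.ofReal b ≤ Heisenberg.distCompl q U / 2 →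
            ENNReal.ofReal θ +
              ∫⁻ P in {P | 0 < Heisenberg.gaugeAt q P.1 ∧ Heisenberg.gaugeAt q P.1 < b},
                ENNReal.ofReal (Heisenberg.tGrad (Heisenberg.arctanPhaseAt q) P ⬝ᵥ
                  Heisenberg.tGrad (Heisenberg.arctanPhaseAt q) P) ∂v
              ≤ ENNReal.ofReal (C * b⁻¹ ^ 2) *
                Heisenberg.weight v {p | b < Heisenberg.dK q p ∧ Heisenberg.dK q p < 2 * b} := by

  obtain ⟨K, hK0, hK⟩ := hχ.exists_bound
  obtain ⟨M, hM⟩ := Heisenberg.exists_abs_Theta_sub_preDensity_le hχ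
  refine ⟨11 * K, by positivity, fun U hU v hv q hq => ⟨fun a ha haU => ?_, fun a b ha hab hbU => ?_,
    ?_⟩⟩
  · exact ⟨Heisenberg.integrable_integrandGauge hχ hv ha haU,
      Heisenberg.integrable_integrandPhase hχ hv ha haU,
      Heisenberg.integrable_integrandCross hχ hv ha haU⟩
  · exact ⟨Heisenberg.Theta_nonneg hχ hv ha ((ENNReal.ofReal_le_ofReal hab.le).trans hbU),
      Heisenberg.Theta_mono hχ hv ha hab.le hbU⟩
  · obtain ⟨θ, hθ0, hlim, hθ⟩ := Heisenberg.exists_tendsto_Theta hχ hv hU hq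
    refine ⟨θ, hθ0, ?_, hlim, fun b hb hbU =>
      (Heisenberg.ofReal_add_lintegral_le hχ hv hθ hb hbU).trans
        (Heisenberg.ofReal_Theta_le hχ hK hv hb hbU)⟩
    obtain ⟨b, hb, hbU⟩ := Heisenberg.exists_pos_ofReal_le_distCompl hU hq
    have hscale : ∀ c : ℝ, 0 < c → Tendsto (fun a : ℝ => c * a) (𝓝[>] 0) (𝓝[>] 0) := by
      intro c hc
      refine tendsto_nhdsWithin_iff.2 ⟨?_, ?_⟩
      · have : Tendsto (fun a : ℝ => c * a) (𝓝 0) (𝓝 (c * 0)) :=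
          (continuous_const.mul continuous_id).tendsto 0
        rw [mul_zero] at this
        exact this.mono_left nhdsWithin_le_nhds
      · filter_upwards [self_mem_nhdsWithin] with a ha using mul_pos hc ha
    -- Both terms have the limit θ, so the energy that controls the cross term vanishes and the
    -- density inherits the limit of Θ^χ.
    have hE : Tendsto (fun a => Heisenberg.Theta χ v q (2 * a) - Heisenberg.Theta χ v q (a / 2))
        (𝓝[>] 0) (𝓝 0) := by
      have h := (hlim.comp (hscale 2 two_pos)).sub (hlim.comp (hscale (1 / 2) (by norm_num)))
      rw [sub_self] at h
      refine h.congr fun a => ?_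
      simp only [Function.comp_apply]
      rw [one_div_mul_eq_div]
    refine Heisenberg.tendsto_of_abs_sub_le_mul_add hlim hE (M := M) ?_
    filter_upwards [Ioc_mem_nhdsGT (half_pos hb)] with a ha
    exact hM U v hv q a ha.1 ((ENNReal.ofReal_le_ofReal (by linarith [ha.2])).trans hbU)
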